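/- Let $A=A_c\sqcup A_i\sqcup A_r$ be a finite alphabet partitioned into call, internal and return letters. A deterministic visibly pushdown machine over $A$ has a finite state set $Q$, a finite stack alphabet $\Gamma$, an initial state $q_0$ and total transition functions $\delta_c:Q\times A_c\to Q\times\Gamma$, $\delta_r:Q\times\Gamma\times A_r\to Q$, $\delta_i:Q\times A_i\to Q$. Its configurations are pairs $(q,\sigma)$ with $q\in Q$ and $\sigma\in\Gamma^*$ (the stack content above the bottom symbol, top first; the empty stack is written $\bot$). A call $c$ with $\delta_c(q,c)=(p,Z)$ leads from $(q,\sigma)$ to $(p,Z\sigma)$, an internal letter $a$ leads from $(q,\sigma)$ to $(\delta_i(q,a),\sigma)$, and a return $r$ leads from $(q,Z\sigma)$ to $(\delta_r(q,Z,r),\sigma)$; there is no transition on a return at the empty stack. A configuration in a finite or infinite run is a *step* if no later configuration of that run has a smaller stack height. A *stair Büchi DVPA* $\mathcal A$ is such a machine with a set $F\subseteq Q$ of final states; it accepts an $\omega$-word if the run from $(q_0,\bot)$ on it exists and has a final state on infinitely many steps. A *parity DVPA* is such a machine with a priority function $\Omega:Q\to\mathbb N$; it accepts an $\omega$-word if the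 run from $(q_0,\bot)$ on it exists and the highest priority that occurs infinitely often in the run is even. Two automata over the same partitioned alphabet are equivalent if they accept the same $\omega$-words. The well-matched words form the smallest set of finite words over $A$ that contains the empty word and every internal letter, is closed under concatenation, and contains $cwr$ for every well-matched $w$, $c\in A_c$, $r\in A_r$; the words of this last form $cwr$ are the *minimally well-matched* words. Write $(p,\sigma)\xrightarrow{u}(p',\sigma')$ if there is a run on $u$ from $(p,\sigma)$ to $(p',\sigma')$. For runs that never go below their initial stack height, write $\xrightarrow[F]{u}$ (respectively $\xrightarrow[\notin F]{u}$) if at least one (respectively no) state from $F$ occurs on a step of this finite run. A *forbidden pattern* of $\mathcal A$ consists of $q,q'\in Q\setminus F$, $q''\in Q$, words $u,v,w,x,y,z\in A^*$ and stack contents $\sigma,\sigma'\in\Gamma^*$ such that $uvwxyz$ is minimally well-matched and $$(q,\bot)\xrightarrow[F]{u}(q,\sigma),\quad (q,\bot)\xrightarrow[\notin F]{v}(q',\bot),\quad (q',\bot)\xrightarrow[\notin F]{w}(q,\sigma'),$$ $$(q,\bot)\xrightarrow{x}(q'',\bot),\quad (q'',\sigma')\xrightarrow{y}(q'',\bot),\quad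 (q'',\sigma)\xrightarrow{z}(q',\bot).$$ **Theorem.** Let $\mathcal A$ be a stair Büchi DVPA all of whose states are reachable (that is, occur in a configuration reachable from $(q_0,\bot)$). Then $\mathcal A$ is equivalent to some parity DVPA over the same partitioned alphabet if and only if $\mathcal A$ has no forbidden pattern. -/

import Mathlib

open Filter

/-- Letters of the partitioned alphabet `A = A_c ∪ A_i ∪ A_r` (a disjoint union), given by the
finite sets `C` of calls, `I` of internal letters and `R` of returns. -/
inductive VPLetter (C I R : Type*) where
  | call (c : C) : VPLetter C I R
  | internal (a : I) : VPLetter C I R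
  | ret (r : R) : VPLetter C I R

namespace VPLetter

variable {C I R : Type*}

/-- Well-matched words (the empty word included). -/
inductive WellMatched : List (VPLetter C I R) → Prop where
  | nil : WellMatched []
  | internal (a : I) : WellMatched [internal a]
  | append {u v : List (VPLetter C I R)} :
      WellMatched u → WellMatched v → WellMatched (u ++ v)
  | wrap {w : List (VPLetter C I R)} (c : C) (r : R) :
      WellMatched w → WellMatched (call c :: (w ++ [ret r]))

/-- Minimally well-matched words: the words `c w r` with a call `c`, a return `r` and a
well-matched word `w`. -/
def MinWellMatched (u : List (VPLetter C I R)) : Prop :=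
  ∃ (c : C) (w : List (VPLetter C I R)) (r : R), WellMatched w ∧ u = call c :: (w ++ [ret r])

end VPLetter

/-- A configuration: a state together with the stack content above the bottom symbol `⊥`, with the
top of the stack at the head of the list. The empty stack is `[]`. -/
abbrev VPConf (Q Γ : Type*) := Q × List Γ

/-- Deterministic visibly pushdown machines with states `Q` and stack alphabet `Γ`. The
transitions do not depend on the topmost stack symbol, except that a return pops it. -/
structure DVPMachine (C I R Q Γ : Type*) where
  init : Q
  callStep : Q → C → Q × Γ
  retStep : Q → Γ → R → Q
  intStep : Q → I → Q

namespace DVPMachine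

variable {C I R Q Γ : Type*} (M : DVPMachine C I R Q Γ)

/-- One move. There is no move on a return letter at the empty stack. -/
def step : VPConf Q Γ → VPLetter C I R → Option (VPConf Q Γ)
  | (q, s), .call c => some ((M.callStep q c).1, (M.callStep q c).2 :: s)
  | (q, s), .internal a => some (M.intStep q a, s)
  | (_, []), .ret _ => none
  | (q, Z :: s), .ret r => some (M.retStep q Z r, s)

/-- `ρ 0, ρ 1, …` is the run on the infinite word `α` from the initial configuration. -/
def IsRun (α : ℕ → VPLetter C I R) (ρ : ℕ → VPConf Q Γ) : Prop :=
  ρ 0 = (M.init, []) ∧ ∀ n, M.step (ρ n) (α n) = some (ρ (n + 1))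

/-- `ρ 0, …, ρ |u|` is a run on the finite word `u` from the configuration `κ` to the configuration
`κ'` (the values of `ρ` beyond `|u|` are irrelevant). -/
def IsFinRun (u : List (VPLetter C I R)) (κ κ' : VPConf Q Γ) (ρ : ℕ → VPConf Q Γ) : Prop :=
  ρ 0 = κ ∧ ρ u.length = κ' ∧
    ∀ (i : ℕ) (h : i < u.length), M.step (ρ i) u[i] = some (ρ (i + 1))

/-- There is a run on `u` from `κ` to `κ'`. -/
def Reach (u : List (VPLetter C I R)) (κ κ' : VPConf Q Γ) : Prop :=
  ∃ ρ, M.IsFinRun u κ κ' ρ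

/-- The state `q` occurs in some configuration reachable from the initial one. -/
def IsReachable (q : Q) : Prop :=
  ∃ (u : List (VPLetter C I R)) (σ : List Γ), M.Reach u (M.init, []) (q, σ)

end DVPMachine

section Steps

variable {Q Γ : Type*}

/-- Position `n` of an infinite sequence of configurations is a step: no later configuration has a
smaller stack. -/
def IsStairStep (ρ : ℕ → VPConf Q Γ) (n : ℕ) : Prop :=
  ∀ m, n ≤ m → (ρ n).2.length ≤ (ρ m).2.length

/-- Position `n` of the finite sequence of configurations `ρ 0, …, ρ N` is a step. -/
def IsFinStairStep (N : ℕ) (ρ : ℕ → VPConf Q Γ) (n : ℕ) : Prop :=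
  n ≤ N ∧ ∀ m, n ≤ m → m ≤ N → (ρ n).2.length ≤ (ρ m).2.length

end Steps

/-- A parity DVPA: a deterministic visibly pushdown machine with a priority function. -/
structure ParityDVPA (C I R Q Γ : Type*) extends DVPMachine C I R Q Γ where
  priority : Q → ℕ

/-- The `ω`-words whose run exists and is such that the highest priority that occurs infinitely
often is even. -/
def ParityDVPA.language {C I R Q Γ : Type*} (B : ParityDVPA C I R Q Γ) :
    Set (ℕ → VPLetter C I R) :=
  {α | ∃ ρ : ℕ → VPConf Q Γ, B.IsRun α ρ ∧ ∃ k : ℕ, Even k ∧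
    IsGreatest {p : ℕ | ∃ᶠ n in atTop, B.priority (ρ n).1 = p} k}

/-- A stair Büchi DVPA: a deterministic visibly pushdown machine with a set of final states. -/
structure StairBuchiDVPA (C I R Q Γ : Type*) extends DVPMachine C I R Q Γ where
  final : Set Q

namespace StairBuchiDVPA

variable {C I R Q Γ : Type*} (A : StairBuchiDVPA C I R Q Γ)

/-- The `ω`-words whose run exists and has a final state on infinitely many steps. -/
def language : Set (ℕ → VPLetter C I R) :=
  {α | ∃ ρ : ℕ → VPConf Q Γ, A.IsRun α ρ ∧
    ∃ᶠ n in atTop, IsStairStep ρ n ∧ (ρ n).1 ∈ A.final}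

/-- There is a run on `u` from `κ` to `κ'`, never going below its initial stack height, that has a
final state on at least one of its steps. -/
def ReachFinal (u : List (VPLetter C I R)) (κ κ' : VPConf Q Γ) : Prop :=
  ∃ ρ, A.IsFinRun u κ κ' ρ ∧ (∀ i ≤ u.length, κ.2.length ≤ (ρ i).2.length) ∧
    ∃ n, IsFinStairStep u.length ρ n ∧ (ρ n).1 ∈ A.final

/-- There is a run on `u` from `κ` to `κ'`, never going below its initial stack height, that has no
final state on any of its steps. -/
def ReachNonfinal (u : List (VPLetter C I R)) (κ κ' : VPConf Q Γ) : Prop :=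
  ∃ ρ, A.IsFinRun u κ κ' ρ ∧ (∀ i ≤ u.length, κ.2.length ≤ (ρ i).2.length) ∧
    ∀ n, IsFinStairStep u.length ρ n → (ρ n).1 ∉ A.final

/-- The states `q, q', q''`, words `u, v, w, x, y, z` and stack contents `σ, σ'` form a forbidden
pattern. -/
structure IsForbiddenPattern (q q' q'' : Q) (u v w x y z : List (VPLetter C I R))
    (σ σ' : List Γ) : Prop where
  q_nonfinal : q ∉ A.final
  q'_nonfinal : q' ∉ A.final
  minWellMatched : VPLetter.MinWellMatched (u ++ v ++ w ++ x ++ y ++ z)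
  run_u : A.ReachFinal u (q, []) (q, σ)
  run_v : A.ReachNonfinal v (q, []) (q', [])
  run_w : A.ReachNonfinal w (q', []) (q, σ')
  run_x : A.Reach x (q, []) (q'', [])
  run_y : A.Reach y (q'', σ') (q'', [])
  run_z : A.Reach z (q'', σ) (q', [])

def HasForbiddenPattern : Prop :=
  ∃ (q q' q'' : Q) (u v w x y z : List (VPLetter C I R)) (σ σ' : List Γ),
    A.IsForbiddenPattern q q' q'' u v w x y z σ σ'

end StairBuchiDVPA

/-! Necessity. A forbidden pattern gives a loop p = wuv at `q'` that shows a final state on a step,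
together with a way to bury that state later. If copies of σ' have been pushed without final steps
after p, then w, x, sufficiently many copies of y, and z pop everything down to the level before u.
The factor from u to z is then minimally well-matched, so its inside contains no step
(`IsForbiddenPattern.embed`). A parity automaton has finitely many priorities, so after a suitable
history the greatest priority k that can still be met no longer decreases. If k is even, one meets k
and buries the final states, again and again. If k is odd, one meets k and runs through p, again and
again. Either way the two automata disagree (`language_ne_of_continuations`).

Sufficiency. A situation is a state b on a step together with a set V of states to which later pops
should lead. There are finitely many situations, so if late steps are not final, the late situations
can reach each other by climbs without final steps. A deterministic machine, the `tracker`, keeps a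
list of records (b, V, Y). The top record is active while the run stays in the class of (b, V). A
lower record is kept while the state lies in Y, from which the run can still get back to that class.
The state before a call goes onto the stack, so at the matching return the tracker treats the
matched factor as a single move from there.

No situation is recorded twice. If no final step was met since, the old record would still be
equivalent to the present situation. Otherwise all states of V are anchored through a final step,
and a minimal-image argument produces a forbidden pattern (`hasForbiddenPattern_of_anchored`,
`RestInv.notMem_reps`). Hence the lists are bounded and finitely many tracker states occur.

Let k be the least number of surviving records that occurs infinitely often. The run is rejected if
and only if, infinitely often, exactly k records survive, these are all the records, and the state
is not final (`frequently_final_iff`). Positions that are not steps do no harm, because records that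
survive a matched factor survive every move inside it (`PredLevel.count_le`). This condition is a
parity condition. -/

namespace VPLetter

/-! ### Stack heights of words and well-matchedness. -/

variable {C I R : Type*}

/-- The change of the stack height caused by a letter. -/
def weight : VPLetter C I R → ℤ
  | call _ => 1
  | internal _ => 0
  | ret _ => -1

/-- The change of the stack height caused by a word. -/
def height (u : List (VPLetter C I R)) : ℤ := (u.map weight).sum

@[simp] theorem height_nil : height ([] : List (VPLetter C I R)) = 0 := rfl

@[simp] theorem height_cons (a : VPLetter C I R) (u : List (VPLetter C I R)) :
    height (a :: u) = weight a + height u := by simp [height]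

@[simp] theorem height_append (u v : List (VPLetter C I R)) :
    height (u ++ v) = height u + height v := by simp [height]

/-- No prefix leads below the initial height. -/
def NonNeg (u : List (VPLetter C I R)) : Prop := ∀ v w, u = v ++ w → 0 ≤ height v

/-- Every nonempty prefix leads above the initial height. -/
def Rising (u : List (VPLetter C I R)) : Prop := u ≠ [] ∧ ∀ v w, u = v ++ w → v ≠ [] → 1 ≤ height v

/-- Every nonempty suffix starts above the final height. -/
def Falling (u : List (VPLetter C I R)) : Prop :=
  u ≠ [] ∧ ∀ v w, u = v ++ w → w ≠ [] → height w ≤ -1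

theorem le_weight (a : VPLetter C I R) : -1 ≤ weight a := by cases a <;> simp [weight]

theorem NonNeg.append {u v : List (VPLetter C I R)} (hu : NonNeg u) (hv : NonNeg v) :
    NonNeg (u ++ v) := by
  intro x y h
  rcases List.append_eq_append_iff.1 h with ⟨a, rfl, rfl⟩ | ⟨b, rfl, rfl⟩
  · rw [height_append]
    exact add_nonneg (hu u [] (by simp)) (hv a y rfl)
  · exact hu x b rfl

theorem Rising.append {u v : List (VPLetter C I R)} (hu : Rising u) (hv : NonNeg v) :
    Rising (u ++ v) := by
  refine ⟨by simp [hu.1], fun x y h hx => ?_⟩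
  rcases List.append_eq_append_iff.1 h with ⟨a, rfl, rfl⟩ | ⟨b, rfl, rfl⟩
  · rw [height_append]
    have := hu.2 u [] (by simp) hu.1
    have := hv a y rfl
    omega
  · exact hu.2 x b rfl hx

theorem rising_call (c : C) : Rising ([call c] : List (VPLetter C I R)) := by
  refine ⟨by simp, fun v w h hv => ?_⟩
  rcases v with _ | ⟨a, v⟩
  · simp at hv
  · simp at h
    obtain ⟨rfl, rfl, rfl⟩ := h
    simp [weight]

theorem falling_append_ret {u v : List (VPLetter C I R)} (hu : NonNeg u) (hu0 : height u = 0)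
    (r : R) (hv : v = [] ∨ Falling v) : Falling (u ++ ret r :: v) := by
  have hv' : height v ≤ 0 := by
    rcases hv with rfl | hv
    · simp
    · have := hv.2 [] v rfl hv.1
      omega
  refine ⟨by simp, fun x y h hy => ?_⟩
  rcases List.append_eq_append_iff.1 h with ⟨a, rfl, ha⟩ | ⟨b, rfl, rfl⟩
  · rcases a with _ | ⟨a, a'⟩
    · simp at ha
      subst ha
      simp [weight]
      omega
    · simp at ha
      obtain ⟨rfl, rfl⟩ := ha
      rcases hv with hv | hv
      · simp at hv
        exact absurd hv.2 hy
      · exact hv.2 a' y rfl hy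
  · have := hu x b rfl
    simp [weight] at *
    omega

theorem WellMatched.nonNeg_and {u : List (VPLetter C I R)} (h : WellMatched u) :
    NonNeg u ∧ height u = 0 := by
  induction h with
  | nil =>
    refine ⟨fun v w h => ?_, rfl⟩
    simp at h
    simp [h.1]
  | internal a =>
    refine ⟨fun v w h => ?_, by simp [weight]⟩
    rcases v with _ | ⟨b, v⟩
    · simp
    · simp at h
      obtain ⟨rfl, rfl, rfl⟩ := h
      simp [weight]
  | append _ _ h1 h2 => exact ⟨h1.1.append h2.1, by simp [h1.2, h2.2]⟩
  | @wrap w c r _ h =>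
    refine ⟨fun x y hxy => ?_, by simp [weight, h.2]⟩
    rcases x with _ | ⟨b, x⟩
    · simp
    · simp only [List.cons_append, List.cons.injEq] at hxy
      obtain ⟨rfl, hxy⟩ := hxy
      rw [height_cons]
      rcases List.append_eq_append_iff.1 hxy with ⟨a, rfl, ha⟩ | ⟨b, rfl, rfl⟩
      · rcases a with _ | ⟨a, a'⟩
        · simp [weight, h.2]
        · simp at ha
          obtain ⟨rfl, rfl, rfl⟩ := ha
          simp [weight, h.2]
      · have := h.1 x b rfl
        simp [weight]
        omega

theorem MinWellMatched.height_eq {u : List (VPLetter C I R)} (h : MinWellMatched u) :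
    height u = 0 := by
  obtain ⟨c, w, r, hw, rfl⟩ := h
  simp [weight, hw.nonNeg_and.2]

theorem MinWellMatched.one_le {u v w : List (VPLetter C I R)} (h : MinWellMatched u)
    (huv : u = v ++ w) (hv : v ≠ []) (hw : w ≠ []) : 1 ≤ height v := by
  obtain ⟨c, x, r, hx, rfl⟩ := h
  rcases v with _ | ⟨b, v⟩
  · simp at hv
  · simp only [List.cons_append, List.cons.injEq] at huv
    obtain ⟨rfl, huv⟩ := huv
    rcases List.append_eq_append_iff.1 huv with ⟨a, rfl, ha⟩ | ⟨b, rfl, rfl⟩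
    · rcases a with _ | ⟨a, a'⟩
      · simp [weight, hx.nonNeg_and.2]
      · simp at ha
        exact absurd ha.2.2 hw
    · have := hx.nonNeg_and.1 v b rfl
      simp [weight]
      omega

/-- The shortest prefix leading to a negative height ends with a return. -/
theorem exists_first_descent {u : List (VPLetter C I R)} (h : ¬ NonNeg u) :
    ∃ (v : List (VPLetter C I R)) (r : R) (w : List (VPLetter C I R)),
      u = v ++ ret r :: w ∧ NonNeg v ∧ height v = 0 := by
  induction u using List.reverseRecOn with
  | nil =>
    refine absurd (fun v w h => ?_) h
    simp at h
    simp [h.1]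
  | append_singleton u a ih =>
    by_cases hu : NonNeg u
    · have h0 : height (u ++ [a]) < 0 := by
        by_contra hc
        refine h fun v w hvw => ?_
        rcases List.eq_nil_or_concat w with rfl | ⟨w, b, rfl⟩
        · rw [List.append_nil] at hvw
          rw [← hvw]
          omega
        · rw [List.concat_eq_append, ← List.append_assoc] at hvw
          exact hu v w (List.append_inj_left' hvw rfl)
      have h1 := hu u [] (by simp)
      simp at h0
      cases a with
      | call c => simp [weight] at h0; omega
      | internal b => simp [weight] at h0; omega
      | ret r => exact ⟨u, r, [], rfl, hu, by simp [weight] at h0; omega⟩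
    · obtain ⟨v, r, w, rfl, h1, h2⟩ := ih hu
      exact ⟨v, r, w ++ [a], by simp, h1, h2⟩

theorem NonNeg.of_append_right {u v : List (VPLetter C I R)} (h : NonNeg (u ++ v))
    (hu : height u = 0) : NonNeg v := by
  intro x y hxy
  have := h (u ++ x) y (by simp [hxy])
  simpa [hu] using this

/-- A leading call is matched by the return at the first descent below the height reached after it;
this splits the word into a wrapped part and a shorter remainder. -/
theorem wellMatched_of_nonNeg (u : List (VPLetter C I R)) (h : NonNeg u) (h0 : height u = 0) :
    WellMatched u := by
  induction hn : u.length using Nat.strong_induction_on generalizing u with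
  | _ n ih =>
    rcases u with _ | ⟨a, u⟩
    · exact .nil
    cases a with
    | ret r =>
      have := h [ret r] u rfl
      simp [weight] at this
    | internal a =>
      have h1 : NonNeg u := NonNeg.of_append_right (u := [internal a]) h (by simp [weight])
      refine WellMatched.append (.internal a) (ih u.length ?_ u h1 ?_ rfl)
      · simp at hn; omega
      · simpa [weight] using h0
    | call c =>
      have h1 : ¬ NonNeg u := by
        intro h1
        have := h1 u [] (by simp)
        simp [weight] at h0
        omega
      obtain ⟨v, r, w, rfl, hv, hv0⟩ := exists_first_descent h1
      simp at hn
      have h2 : height (call c :: (v ++ [ret r])) = 0 := by simp [weight, hv0]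
      have h3 : NonNeg w := NonNeg.of_append_right (u := call c :: (v ++ [ret r]))
        (by simpa using h) h2
      have h4 : WellMatched (call c :: (v ++ [ret r]) ++ w) :=
        .append (.wrap c r (ih v.length (by omega) v hv hv0 rfl))
          (ih w.length (by omega) w h3 (by simpa [weight, hv0] using h0) rfl)
      simpa using h4

/-- Lets the middle of a minimally well-matched word be exchanged: the rising prefix and the falling
suffix alone keep the interior above the ends. -/
theorem minWellMatched_of_rising_falling {u v w : List (VPLetter C I R)} (hu : Rising u)
    (hv : NonNeg v) (hv0 : height v = 0) (hw : Falling w) (h0 : height u + height w = 0) :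
    MinWellMatched (u ++ v ++ w) := by
  obtain ⟨a, u, rfl⟩ := List.exists_cons_of_ne_nil hu.1
  obtain ⟨w, b, rfl⟩ : ∃ w' b, w = w' ++ [b] := by
    rcases List.eq_nil_or_concat w with h | ⟨w', b, h⟩
    · exact absurd h hw.1
    · exact ⟨w', b, by simpa using h⟩
  have ha := hu.2 [a] u rfl (by simp)
  have hb := hw.2 w [b] rfl (by simp)
  obtain ⟨c, rfl⟩ : ∃ c, a = call c := by
    cases a with
    | call c => exact ⟨c, rfl⟩
    | internal a => simp [weight] at ha
    | ret r => simp [weight] at ha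
  obtain ⟨r, rfl⟩ : ∃ r, b = ret r := by
    cases b with
    | call c => simp [weight] at hb
    | internal a => simp [weight] at hb
    | ret r => exact ⟨r, rfl⟩
  refine ⟨c, u ++ v ++ w, r, wellMatched_of_nonNeg _ ?_ ?_, by simp⟩
  · intro x y hxy
    simp only [height_append, height_cons] at h0
    have hfull : ∀ s, height (call c :: s : List (VPLetter C I R)) = 1 + height s := by
      intro s; simp [weight]
    rw [List.append_assoc] at hxy
    rcases List.append_eq_append_iff.1 hxy with ⟨a, rfl, ha⟩ | ⟨b, rfl, rfl⟩
    · have h1 := hu.2 (call c :: u) [] (by simp) (by simp)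
      rw [hfull] at h1
      rcases List.append_eq_append_iff.1 ha with ⟨a', rfl, ha'⟩ | ⟨b', rfl, rfl⟩
      · have h2 := hw.2 a' (y ++ [ret r]) (by rw [ha']; simp) (by simp)
        rw [ha'] at h0
        simp [weight] at *
        omega
      · have := hv a b' rfl
        simp
        omega
    · have h1 := hu.2 (call c :: x) b rfl (by simp)
      rw [hfull] at h1
      omega
  · simp [weight] at *
    omega

end VPLetter

/-! ### Runs: concatenation, adding and removing a stack bottom, uniqueness. -/

namespace DVPMachine

open VPLetter

variable {C I R Q Γ : Type*} {M : DVPMachine C I R Q Γ}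

theorem step_height {κ κ' : VPConf Q Γ} {a : VPLetter C I R} (h : M.step κ a = some κ') :
    (κ'.2.length : ℤ) = κ.2.length + weight a := by
  obtain ⟨q, s⟩ := κ
  cases a with
  | call c => simp [step] at h; subst h; simp [weight]
  | internal a => simp [step] at h; subst h; simp [weight]
  | ret r =>
    cases s with
    | nil => simp [step] at h
    | cons Z s => simp [step] at h; subst h; simp [weight]

theorem step_lift {q q' : Q} {s s' : List Γ} {a : VPLetter C I R} (τ : List Γ)
    (h : M.step (q, s) a = some (q', s')) : M.step (q, s ++ τ) a = some (q', s' ++ τ) := by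
  cases a with
  | call c => simp [step] at *; grind
  | internal a => simp [step] at *; grind
  | ret r =>
    cases s with
    | nil => simp [step] at h
    | cons Z s => simp [step] at *; grind

/-- The height bound excludes the only move that could touch `τ`, a return with `s` empty. -/
theorem step_unlift {q : Q} {s τ : List Γ} {κ : VPConf Q Γ} {a : VPLetter C I R}
    (h : M.step (q, s ++ τ) a = some κ) (hl : τ.length ≤ κ.2.length) :
    ∃ s', κ.2 = s' ++ τ ∧ M.step (q, s) a = some (κ.1, s') := by
  cases a with
  | call c => simp [step] at h; subst h; exact ⟨_ :: s, by simp, rfl⟩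
  | internal a => simp [step] at h; subst h; exact ⟨s, rfl, rfl⟩
  | ret r =>
    cases s with
    | nil =>
      have := step_height h
      simp [weight] at this
      omega
    | cons Z s => simp [step] at h; subst h; exact ⟨s, rfl, rfl⟩

/-- Two runs one after the other. -/
def glue (n : ℕ) (ρ₁ ρ₂ : ℕ → VPConf Q Γ) (i : ℕ) : VPConf Q Γ :=
  if i ≤ n then ρ₁ i else ρ₂ (i - n)

theorem glue_left {n i : ℕ} {ρ₁ ρ₂ : ℕ → VPConf Q Γ} (h : i ≤ n) : glue n ρ₁ ρ₂ i = ρ₁ i :=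
  if_pos h

theorem glue_right {n i : ℕ} {ρ₁ ρ₂ : ℕ → VPConf Q Γ} (h : ρ₁ n = ρ₂ 0) :
    glue n ρ₁ ρ₂ (n + i) = ρ₂ i := by
  unfold glue
  split_ifs with h'
  · obtain rfl : i = 0 := by omega
    simpa using h
  · simp

theorem IsFinRun.glue {u v : List (VPLetter C I R)} {κ κ' κ'' : VPConf Q Γ}
    {ρ₁ ρ₂ : ℕ → VPConf Q Γ} (h₁ : M.IsFinRun u κ κ' ρ₁) (h₂ : M.IsFinRun v κ' κ'' ρ₂) :
    M.IsFinRun (u ++ v) κ κ'' (glue u.length ρ₁ ρ₂) := by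
  have hm : ρ₁ u.length = ρ₂ 0 := by rw [h₁.2.1, h₂.1]
  refine ⟨by rw [glue_left (by omega), h₁.1], ?_, fun i hi => ?_⟩
  · rw [List.length_append, glue_right hm, h₂.2.1]
  · rcases lt_or_ge i u.length with h | h
    · rw [glue_left h.le, glue_left h, List.getElem_append_left h]
      exact h₁.2.2 i h
    · obtain ⟨j, rfl⟩ := Nat.exists_eq_add_of_le h
      rw [glue_right hm, add_assoc, glue_right hm, List.getElem_append_right h]
      simp only [Nat.add_sub_cancel_left]
      exact h₂.2.2 j (by simp at hi; omega)

theorem IsFinRun.lift {u : List (VPLetter C I R)} {q q' : Q} {s s' : List Γ}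
    {ρ : ℕ → VPConf Q Γ} (h : M.IsFinRun u (q, s) (q', s') ρ) (τ : List Γ) :
    M.IsFinRun u (q, s ++ τ) (q', s' ++ τ) (fun i => ((ρ i).1, (ρ i).2 ++ τ)) := by
  refine ⟨by simp [h.1], by simp [h.2.1], fun i hi => ?_⟩
  exact step_lift τ (h.2.2 i hi)

theorem IsFinRun.height {u : List (VPLetter C I R)} {κ κ' : VPConf Q Γ} {ρ : ℕ → VPConf Q Γ}
    (h : M.IsFinRun u κ κ' ρ) (i : ℕ) (hi : i ≤ u.length) :
    ((ρ i).2.length : ℤ) = κ.2.length + VPLetter.height (u.take i) := by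
  induction i with
  | zero => simp [h.1]
  | succ i ih =>
    have := step_height (h.2.2 i (by omega))
    rw [this, ih (by omega), List.take_succ_eq_append_getElem (by omega), height_append,
      height_cons, height_nil]
    ring

theorem Reach.refl (κ : VPConf Q Γ) : M.Reach [] κ κ :=
  ⟨fun _ => κ, rfl, rfl, fun i h => by simp at h⟩

theorem Reach.single {κ κ' : VPConf Q Γ} {a : VPLetter C I R} (h : M.step κ a = some κ') :
    M.Reach [a] κ κ' :=
  ⟨fun i => if i = 0 then κ else κ', rfl, rfl, fun i hi => by
    obtain rfl : i = 0 := by simpa using hi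
    simpa using h⟩

theorem Reach.append {u v : List (VPLetter C I R)} {κ κ' κ'' : VPConf Q Γ}
    (h₁ : M.Reach u κ κ') (h₂ : M.Reach v κ' κ'') : M.Reach (u ++ v) κ κ'' := by
  obtain ⟨ρ₁, h₁⟩ := h₁
  obtain ⟨ρ₂, h₂⟩ := h₂
  exact ⟨_, h₁.glue h₂⟩

theorem Reach.lift {u : List (VPLetter C I R)} {q q' : Q} {s s' : List Γ}
    (h : M.Reach u (q, s) (q', s')) (τ : List Γ) : M.Reach u (q, s ++ τ) (q', s' ++ τ) := by
  obtain ⟨ρ, h⟩ := h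
  exact ⟨_, h.lift τ⟩

theorem Reach.height_eq {u : List (VPLetter C I R)} {κ κ' : VPConf Q Γ} (h : M.Reach u κ κ') :
    (κ'.2.length : ℤ) = κ.2.length + height u := by
  obtain ⟨ρ, h⟩ := h
  have := h.height u.length le_rfl
  rwa [h.2.1, List.take_length] at this

theorem Reach.nonNeg {u : List (VPLetter C I R)} {p : Q} {κ : VPConf Q Γ}
    (h : M.Reach u (p, []) κ) : NonNeg u := by
  obtain ⟨ρ, h⟩ := h
  rintro v w rfl
  have := h.height v.length (by simp)
  simp at this
  omega

theorem IsFinRun.unique {u : List (VPLetter C I R)} {κ κ₁ κ₂ : VPConf Q Γ}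
    {ρ₁ ρ₂ : ℕ → VPConf Q Γ} (h₁ : M.IsFinRun u κ κ₁ ρ₁) (h₂ : M.IsFinRun u κ κ₂ ρ₂) (i : ℕ)
    (hi : i ≤ u.length) : ρ₁ i = ρ₂ i := by
  induction i with
  | zero => rw [h₁.1, h₂.1]
  | succ i ih =>
    have e1 := h₁.2.2 i (by omega)
    have e2 := h₂.2.2 i (by omega)
    rw [ih (by omega), e2] at e1
    exact (Option.some.inj e1).symm

/-- The part of an infinite word between two positions. -/
def segment (α : ℕ → VPLetter C I R) (m n : ℕ) : List (VPLetter C I R) :=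
  (List.range (n - m)).map fun i => α (m + i)

@[simp] theorem length_segment (α : ℕ → VPLetter C I R) (m n : ℕ) :
    (segment α m n).length = n - m := by simp [segment]

theorem IsRun.isFinRun {α : ℕ → VPLetter C I R} {ρ : ℕ → VPConf Q Γ} (h : M.IsRun α ρ) {m n : ℕ}
    (hmn : m ≤ n) : M.IsFinRun (segment α m n) (ρ m) (ρ n) (fun i => ρ (m + i)) := by
  refine ⟨rfl, by simp [hmn], fun i hi => ?_⟩
  simpa [segment, add_assoc] using h.2 (m + i)

/-- While the stack never gets shorter than `τ`, this bottom part is neither read nor changed, so it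
can be cut off from the run. -/
theorem IsRun.isFinRun_of_le {α : ℕ → VPLetter C I R} {ρ : ℕ → VPConf Q Γ} (h : M.IsRun α ρ)
    {m n : ℕ} (hmn : m ≤ n) {s τ : List Γ} (hs : (ρ m).2 = s ++ τ)
    (hl : ∀ i, m ≤ i → i ≤ n → τ.length ≤ (ρ i).2.length) :
    ∃ σ, (ρ n).2 = σ ++ τ ∧ ∃ ρ', M.IsFinRun (segment α m n) ((ρ m).1, s) ((ρ n).1, σ) ρ' ∧
      ∀ i ≤ n - m, (ρ' i).1 = (ρ (m + i)).1 ∧ (ρ' i).2 ++ τ = (ρ (m + i)).2 := by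
  have key : ∀ i, i ≤ n - m → ∃ σ, (ρ (m + i)).2 = σ ++ τ := by
    intro i
    induction i with
    | zero => exact fun _ => ⟨s, hs⟩
    | succ i ih =>
      intro hi
      obtain ⟨σ, hσ⟩ := ih (by omega)
      have h1 := h.2 (m + i)
      rw [show ρ (m + i) = ((ρ (m + i)).1, σ ++ τ) from Prod.ext rfl hσ] at h1
      obtain ⟨s', h2, -⟩ := step_unlift h1 (hl _ (by omega) (by omega))
      exact ⟨s', h2⟩
  choose! f hf using key
  have h0 : f 0 = s := by
    have := hf 0 (by omega)
    rw [add_zero, hs] at this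
    exact (List.append_cancel_right this).symm
  have hn : (ρ n).2 = f (n - m) ++ τ := by
    have := hf (n - m) le_rfl
    rwa [show m + (n - m) = n by omega] at this
  refine ⟨f (n - m), hn, fun i => ((ρ (m + i)).1, f i), ⟨by simp [h0], ?_, fun i hi => ?_⟩,
    fun i hi => ⟨rfl, (hf i hi).symm⟩⟩
  · simp [hmn]
  · simp at hi
    have h1 := h.2 (m + i)
    rw [show ρ (m + i) = ((ρ (m + i)).1, f i ++ τ) from Prod.ext rfl (hf i (by omega))] at h1
    obtain ⟨s', h2, h3⟩ := step_unlift h1 (hl _ (by omega) (by omega))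
    have h4 := hf (i + 1) (by omega)
    rw [← add_assoc, h2] at h4
    obtain rfl := List.append_cancel_right h4
    simpa [segment, add_assoc] using h3

theorem step_isSome_iff {Q' Γ' : Type*} {M' : DVPMachine C I R Q' Γ'} {κ : VPConf Q Γ}
    {κ' : VPConf Q' Γ'} (h : κ.2.length = κ'.2.length) (a : VPLetter C I R) :
    (M.step κ a).isSome ↔ (M'.step κ' a).isSome := by
  obtain ⟨q, s⟩ := κ
  obtain ⟨q', s'⟩ := κ'
  cases a with
  | call c => simp [step]
  | internal a => simp [step]
  | ret r =>
    cases s <;> cases s' <;> simp [step] at *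

/-- Whether there is a run on an infinite word does not depend on the machine. -/
theorem IsRun.exists_isRun {α : ℕ → VPLetter C I R} {ρ : ℕ → VPConf Q Γ} (h : M.IsRun α ρ)
    {Q' Γ' : Type*} (M' : DVPMachine C I R Q' Γ') :
    ∃ ρ', M'.IsRun α ρ' ∧ ∀ n, (ρ' n).2.length = (ρ n).2.length := by
  let ρ' : ℕ → VPConf Q' Γ' := fun n =>
    Nat.rec (M'.init, []) (fun n κ => (M'.step κ (α n)).getD κ) n
  have hs : ∀ n, (ρ' n).2.length = (ρ n).2.length → M'.step (ρ' n) (α n) = some (ρ' (n + 1)) := by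
    intro n hn
    have h1 : (M'.step (ρ' n) (α n)).isSome := by
      rw [← step_isSome_iff (M := M) hn.symm, h.2 n]
      rfl
    obtain ⟨κ, hκ⟩ := Option.isSome_iff_exists.1 h1
    rw [hκ, show ρ' (n + 1) = (M'.step (ρ' n) (α n)).getD (ρ' n) from rfl, hκ]
    rfl
  have hl : ∀ n, (ρ' n).2.length = (ρ n).2.length := by
    intro n
    induction n with
    | zero => rw [h.1]; rfl
    | succ n ih =>
      have h1 := step_height (hs n ih)
      have h2 := step_height (h.2 n)
      omega
  exact ⟨ρ', ⟨rfl, fun n => hs n (hl n)⟩, hl⟩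

theorem IsRun.unique {α : ℕ → VPLetter C I R} {ρ ρ' : ℕ → VPConf Q Γ} (h : M.IsRun α ρ)
    (h' : M.IsRun α ρ') : ρ = ρ' := by
  funext n
  induction n with
  | zero => rw [h.1, h'.1]
  | succ n ih =>
    have e1 := h.2 n
    rw [ih, h'.2 n] at e1
    exact (Option.some.inj e1).symm

/-- Runs are preserved by homomorphisms of machines. -/
theorem IsRun.map {Q' Γ' : Type*} {M' : DVPMachine C I R Q' Γ'} (f : Q → Q') (g : Γ → Γ')
    (h0 : f M.init = M'.init)
    (hc : ∀ q c, M'.callStep (f q) c = (f (M.callStep q c).1, g (M.callStep q c).2))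
    (hr : ∀ q Z r, M'.retStep (f q) (g Z) r = f (M.retStep q Z r))
    (hi : ∀ q a, M'.intStep (f q) a = f (M.intStep q a))
    {α : ℕ → VPLetter C I R} {ρ : ℕ → VPConf Q Γ} (h : M.IsRun α ρ) :
    M'.IsRun α (fun n => (f (ρ n).1, (ρ n).2.map g)) := by
  refine ⟨by simp [h.1, h0], fun n => ?_⟩
  have h1 := h.2 n
  revert h1
  dsimp only
  generalize ρ (n + 1) = κ'
  generalize ρ n = κ
  obtain ⟨q, s⟩ := κ
  cases α n with
  | call c => simp only [step]; intro h; simp at h; subst h; simp [hc]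
  | internal a => simp only [step]; intro h; simp at h; subst h; simp [hi]
  | ret r =>
    cases s with
    | nil => simp [step]
    | cons Z s => simp only [step, List.map_cons]; intro h; simp at h; subst h; simp [hr]

end DVPMachine

/-! ### Runs with and without final states on their steps. -/

namespace StairBuchiDVPA

open VPLetter DVPMachine

variable {C I R Q Γ : Type*} {A : StairBuchiDVPA C I R Q Γ}

theorem ReachFinal.reach {u : List (VPLetter C I R)} {κ κ' : VPConf Q Γ}
    (h : A.ReachFinal u κ κ') : A.Reach u κ κ' := by
  obtain ⟨ρ, h, -⟩ := h
  exact ⟨ρ, h⟩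

theorem ReachNonfinal.reach {u : List (VPLetter C I R)} {κ κ' : VPConf Q Γ}
    (h : A.ReachNonfinal u κ κ') : A.Reach u κ κ' := by
  obtain ⟨ρ, h, -⟩ := h
  exact ⟨ρ, h⟩

theorem ReachNonfinal.right {u : List (VPLetter C I R)} {κ κ' : VPConf Q Γ}
    (h : A.ReachNonfinal u κ κ') : κ'.1 ∉ A.final := by
  obtain ⟨ρ, h, -, h'⟩ := h
  rw [← h.2.1]
  refine h' _ ⟨le_rfl, fun m h1 h2 => ?_⟩
  rw [le_antisymm h1 h2]

theorem ReachNonfinal.left {u : List (VPLetter C I R)} {κ κ' : VPConf Q Γ}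
    (h : A.ReachNonfinal u κ κ') : κ.1 ∉ A.final := by
  obtain ⟨ρ, h, hl, h'⟩ := h
  rw [← h.1]
  refine h' _ ⟨by omega, fun m h1 h2 => ?_⟩
  rw [h.1]
  exact hl m h2

theorem ReachNonfinal.refl {κ : VPConf Q Γ} (h : κ.1 ∉ A.final) : A.ReachNonfinal [] κ κ :=
  ⟨fun _ => κ, ⟨rfl, rfl, fun i h => by simp at h⟩, fun _ _ => le_rfl, fun _ _ => h⟩

theorem ReachNonfinal.append {u v : List (VPLetter C I R)} {κ κ' κ'' : VPConf Q Γ}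
    (h₁ : A.ReachNonfinal u κ κ') (h₂ : A.ReachNonfinal v κ' κ'')  :
    A.ReachNonfinal (u ++ v) κ κ'' := by
  obtain ⟨ρ₁, h₁, l₁, f₁⟩ := h₁
  obtain ⟨ρ₂, h₂, l₂, f₂⟩ := h₂
  have hm : ρ₁ u.length = ρ₂ 0 := by rw [h₁.2.1, h₂.1]
  have hκ : κ.2.length ≤ κ'.2.length := by rw [← h₁.2.1]; exact l₁ _ le_rfl
  refine ⟨_, h₁.glue h₂, fun i hi => ?_, fun n hn => ?_⟩
  · rcases le_or_gt i u.length with h | h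
    · rw [glue_left h]
      exact l₁ i h
    · obtain ⟨j, rfl⟩ := Nat.exists_eq_add_of_le h.le
      rw [glue_right hm]
      exact hκ.trans (l₂ j (by simp at hi; omega))
  · rcases le_or_gt n u.length with h | h
    · rw [glue_left h]
      refine f₁ n ⟨h, fun m h1 h2 => ?_⟩
      have := hn.2 m h1 (by simp; omega)
      rwa [glue_left h, glue_left h2] at this
    · obtain ⟨j, rfl⟩ := Nat.exists_eq_add_of_le h.le
      rw [glue_right hm]
      have hj := hn.1
      simp at hj
      refine f₂ j ⟨by omega, fun m h1 h2 => ?_⟩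
      have := hn.2 (u.length + m) (by omega) (by simp; omega)
      rwa [glue_right hm, glue_right hm] at this

theorem ReachNonfinal.lift {u : List (VPLetter C I R)} {q q' : Q} {s s' : List Γ}
    (h : A.ReachNonfinal u (q, s) (q', s')) (τ : List Γ) :
    A.ReachNonfinal u (q, s ++ τ) (q', s' ++ τ) := by
  obtain ⟨ρ, h, l, f⟩ := h
  refine ⟨_, h.lift τ, fun i hi => ?_, fun n hn => f n ⟨hn.1, fun m h1 h2 => ?_⟩⟩
  · simpa using l i hi
  · simpa using hn.2 m h1 h2

theorem ReachFinal.lift {u : List (VPLetter C I R)} {q q' : Q} {s s' : List Γ}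
    (h : A.ReachFinal u (q, s) (q', s')) (τ : List Γ) :
    A.ReachFinal u (q, s ++ τ) (q', s' ++ τ) := by
  obtain ⟨ρ, h, l, n, hn, f⟩ := h
  refine ⟨_, h.lift τ, fun i hi => ?_, n, ⟨hn.1, fun m h1 h2 => ?_⟩, f⟩
  · simpa using l i hi
  · simpa using hn.2 m h1 h2

/-- Composition of runs that start at the empty stack. -/
theorem ReachNonfinal.comp {u v : List (VPLetter C I R)} {p q r : Q} {σ τ : List Γ}
    (h₁ : A.ReachNonfinal u (p, []) (q, σ)) (h₂ : A.ReachNonfinal v (q, []) (r, τ)) :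
    A.ReachNonfinal (u ++ v) (p, []) (r, τ ++ σ) :=
  h₁.append (by simpa using h₂.lift σ)

theorem ReachFinal.comp {u v : List (VPLetter C I R)} {p q r : Q} {σ τ : List Γ}
    (h₁ : A.ReachFinal u (p, []) (q, σ)) (h₂ : A.Reach v (q, []) (r, τ)) :
    A.ReachFinal (u ++ v) (p, []) (r, τ ++ σ) := by
  obtain ⟨ρ₁, h₁, l₁, n, hn, f⟩ := h₁
  obtain ⟨ρ₂, h₂⟩ := h₂
  have h₂' := h₂.lift σ
  simp only [List.nil_append] at h₂'
  have hm : ρ₁ u.length = ((ρ₂ 0).1, (ρ₂ 0).2 ++ σ) := by rw [h₁.2.1, h₂.1]; rfl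
  refine ⟨_, h₁.glue h₂', fun i hi => by simp, n,
    ⟨by have := hn.1; simp; omega, fun m h1 h2 => ?_⟩, ?_⟩
  · rw [glue_left hn.1]
    rcases le_or_gt m u.length with h | h
    · rw [glue_left h]
      exact hn.2 m h1 h
    · obtain ⟨j, rfl⟩ := Nat.exists_eq_add_of_le h.le
      rw [glue_right (ρ₂ := fun i => ((ρ₂ i).1, (ρ₂ i).2 ++ σ)) hm]
      have := hn.2 u.length hn.1 le_rfl
      rw [h₁.2.1] at this
      simp at *
      omega
  · rw [glue_left hn.1]
    exact f

theorem _root_.DVPMachine.Reach.comp {M : DVPMachine C I R Q Γ} {u v : List (VPLetter C I R)}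
    {p q r : Q} {σ τ : List Γ} (h₁ : M.Reach u (p, []) (q, σ)) (h₂ : M.Reach v (q, []) (r, τ)) :
    M.Reach (u ++ v) (p, []) (r, τ ++ σ) :=
  h₁.append (by simpa using h₂.lift σ)

theorem reachFinal_of_right {u : List (VPLetter C I R)} {p q : Q} {σ : List Γ}
    (h : A.Reach u (p, []) (q, σ)) (hq : q ∈ A.final) : A.ReachFinal u (p, []) (q, σ) := by
  obtain ⟨ρ, h⟩ := h
  refine ⟨ρ, h, fun i _ => by simp, u.length, ⟨le_rfl, fun m h1 h2 => ?_⟩, by rw [h.2.1]; exact hq⟩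
  rw [le_antisymm h1 h2]

/-- All positions strictly between the ends are above the final height: the ends are the only
steps. -/
theorem reachNonfinal_of_interior {u : List (VPLetter C I R)} {p q : Q} {σ : List Γ}
    (h : A.Reach u (p, []) (q, σ)) (hp : p ∉ A.final) (hq : q ∉ A.final)
    (hu : ∀ v w, u = v ++ w → v ≠ [] → w ≠ [] → (σ.length : ℤ) < height v) :
    A.ReachNonfinal u (p, []) (q, σ) := by
  obtain ⟨ρ, h⟩ := h
  refine ⟨ρ, h, fun i _ => by simp, fun n hn => ?_⟩
  rcases Nat.eq_zero_or_pos n with rfl | h0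
  · rwa [h.1]
  rcases hn.1.eq_or_lt with rfl | h1
  · rwa [h.2.1]
  exfalso
  have h2 := hu (u.take n) (u.drop n) (by simp) (by
    intro h; have := congrArg List.length h; simp at this; rcases this with h | h
    · omega
    · subst h; simp at h1) (by
    intro h; have := congrArg List.length h; simp at this; omega)
  have h3 := hn.2 u.length h1.le le_rfl
  rw [h.2.1] at h3
  have h4 := h.height n h1.le
  simp at h4 h3
  omega

end StairBuchiDVPA

/-! ### Infinite words as limits of finite ones. -/

namespace DVPMachine

open VPLetter

variable {C I R Q Γ : Type*} {M : DVPMachine C I R Q Γ}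

theorem segment_zero_succ (α : ℕ → VPLetter C I R) (n : ℕ) :
    segment α 0 (n + 1) = segment α 0 n ++ [α n] := by
  simp [segment, List.range_succ]

theorem segment_append (α : ℕ → VPLetter C I R) {l m n : ℕ} (h₁ : l ≤ m) (h₂ : m ≤ n) :
    segment α l m ++ segment α m n = segment α l n := by
  refine List.ext_getElem (by simp; omega) fun i hi hi' => ?_
  rcases lt_or_ge i (segment α l m).length with h | h
  · rw [List.getElem_append_left h]
    simp [segment]
  · rw [List.getElem_append_right h]
    simp at h
    simp [segment]
    congr 1
    omega

/-- The configuration after a word; moves that are not possible are ignored. -/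
def conf (M : DVPMachine C I R Q Γ) (u : List (VPLetter C I R)) : VPConf Q Γ :=
  u.foldl (fun κ a => (M.step κ a).getD κ) (M.init, [])

theorem IsRun.conf_eq {α : ℕ → VPLetter C I R} {ρ : ℕ → VPConf Q Γ} (h : M.IsRun α ρ) (n : ℕ) :
    M.conf (segment α 0 n) = ρ n := by
  induction n with
  | zero => simp [conf, segment, h.1]
  | succ n ih =>
    unfold conf at *
    rw [segment_zero_succ, List.foldl_append, ih]
    simp [h.2 n]

theorem IsRun.eq_of_isFinRun {α : ℕ → VPLetter C I R} {ρ ρ' : ℕ → VPConf Q Γ} (h : M.IsRun α ρ)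
    {m n : ℕ} (hmn : m ≤ n) {κ κ' : VPConf Q Γ} {u : List (VPLetter C I R)}
    (hu : segment α m n = u) (hκ : ρ m = κ) (h' : M.IsFinRun u κ κ' ρ') (i : ℕ)
    (hi : i ≤ n - m) : ρ (m + i) = ρ' i := by
  subst hu hκ
  exact (h.isFinRun hmn).unique h' i (by simpa using hi)

theorem IsRun.eq_of_reach {α : ℕ → VPLetter C I R} {ρ : ℕ → VPConf Q Γ} (h : M.IsRun α ρ)
    {m n : ℕ} (hmn : m ≤ n) {κ κ' : VPConf Q Γ} {u : List (VPLetter C I R)}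
    (hu : segment α m n = u) (hκ : ρ m = κ) (h' : M.Reach u κ κ') : ρ n = κ' := by
  obtain ⟨ρ', h'⟩ := h'
  have := h.eq_of_isFinRun hmn hu hκ h' (n - m) le_rfl
  rw [show m + (n - m) = n by omega] at this
  rw [this, ← h'.2.1, ← hu]
  simp

/-- The total function `conf` is the candidate; on each prefix it agrees with a finite run that
extends far enough. -/
theorem exists_isRun_of_reach {α : ℕ → VPLetter C I R}
    (h : ∀ n, ∃ m κ, n ≤ m ∧ M.Reach (segment α 0 m) (M.init, []) κ) : ∃ ρ, M.IsRun α ρ := by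
  refine ⟨fun n => M.conf (segment α 0 n), by simp [conf, segment], fun n => ?_⟩
  obtain ⟨m, κ, hm, ρ, hρ⟩ := h (n + 1)
  have key : ∀ i, i ≤ m → M.conf (segment α 0 i) = ρ i := by
    intro i
    induction i with
    | zero => intro _; simp [conf, segment, hρ.1]
    | succ i ih =>
      intro hi
      have h1 := hρ.2.2 i (by simp; omega)
      unfold conf at *
      rw [segment_zero_succ, List.foldl_append, ih (by omega)]
      simp [segment] at h1
      simp [h1]
  dsimp only
  rw [key n (by omega), key (n + 1) hm]
  simpa [segment] using hρ.2.2 n (by simp; omega)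

theorem exists_limit_word (H : ℕ → List (VPLetter C I R))
    (hH : ∀ n, ∃ x, x ≠ [] ∧ H (n + 1) = H n ++ x) :
    ∃ α : ℕ → VPLetter C I R, ∀ n, segment α 0 (H n).length = H n := by
  have hlen : ∀ n, n ≤ (H n).length := by
    intro n
    induction n with
    | zero => omega
    | succ n ih =>
      obtain ⟨x, hx, h⟩ := hH n
      have := List.length_pos_iff.2 hx
      rw [h, List.length_append]
      omega
  have hpre : ∀ m n, m ≤ n → H m <+: H n := by
    intro m n hmn
    induction n, hmn using Nat.le_induction with
    | base => exact List.prefix_rfl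
    | succ n _ ih =>
      obtain ⟨x, -, h⟩ := hH n
      rw [h]
      exact ih.trans (List.prefix_append _ _)
  refine ⟨fun i => (H (i + 1))[i]'(hlen (i + 1)), fun n => ?_⟩
  refine List.ext_getElem (by simp) fun i hi hi' => ?_
  simp only [segment, List.getElem_map, List.getElem_range]
  have h1 := hlen (i + 1)
  rcases le_total (i + 1) n with h | h
  · simpa using (hpre _ _ h).getElem (i := i) (by omega)
  · simpa using ((hpre _ _ h).getElem (i := i) hi').symm

end DVPMachine

/-! ### Necessity: a word on which stair and parity acceptance differ. -/

namespace StairBuchiDVPA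

open VPLetter DVPMachine

variable {C I R Q Γ : Type*} {A : StairBuchiDVPA C I R Q Γ}

/-- If from a configuration one can always both see a final state on a step and close all steps
with final states again, then the language is not accepted by a parity automaton. -/
theorem language_ne_of_continuations {Q' Γ' : Type*} [Finite Q'] (B : ParityDVPA C I R Q' Γ')
    (T : Set (List (VPLetter C I R))) (q : Q) (p : List (VPLetter C I R))
    (hT : ∀ s ∈ T, ∀ t ∈ T, s ++ t ∈ T) (hp : p ∈ T) (hnil : p ≠ [])
    (hreach : ∀ t ∈ T, ∃ τ, A.Reach t (q, []) (q, τ))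
    (hfin : ∃ τ, A.ReachFinal p (q, []) (q, τ))
    (hclose : ∀ t ∈ T, ∃ s τ, t ++ s ∈ T ∧ A.ReachNonfinal (t ++ s) (q, []) (q, τ))
    (hq : A.IsReachable q) : B.language ≠ A.language := by
  obtain ⟨h₀, τ₀, hh₀⟩ := hq
  let Vis : List (VPLetter C I R) → ℕ → Prop := fun h k =>
    ∃ t ∈ T, ∃ a b, t = a ++ b ∧ a ≠ [] ∧ B.priority (B.conf (h ++ a)).1 = k
  have hmono : ∀ h, ∀ t ∈ T, ∀ k, Vis (h ++ t) k → Vis h k := by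
    rintro h t ht k ⟨s, hs, a, b, rfl, ha, hk⟩
    exact ⟨t ++ (a ++ b), hT t ht _ hs, t ++ a, b, by simp, by simp [ha], by simpa using hk⟩
  have hgr : ∀ h, ∃ k, IsGreatest {j | Vis h j} k := by
    intro h
    have hf : {j | Vis h j}.Finite := by
      refine (Set.finite_range B.priority).subset ?_
      rintro k ⟨t, _, a, b, _, _, rfl⟩
      exact ⟨_, rfl⟩
    have hne : {j | Vis h j}.Nonempty := ⟨_, p, hp, p, [], by simp, hnil, rfl⟩
    obtain ⟨k, hk⟩ := hf.exists_maximal hne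
    refine ⟨k, hk.1, fun j hj => ?_⟩
    by_contra hc
    exact hc (hk.2 hj (by omega))
  -- Reading further words of `T` can only lower the greatest visible priority. At a history where
  -- it is least, it therefore stays equal to `k` on all continuations.
  obtain ⟨k, ⟨t₁, ht₁, hk⟩, hmin⟩ : ∃ k, (∃ t ∈ T, IsGreatest {j | Vis (h₀ ++ t) j} k) ∧
      ∀ j, (∃ t ∈ T, IsGreatest {j | Vis (h₀ ++ t) j} j) → k ≤ j := by
    classical
    have hex : ∃ k, ∃ t ∈ T, IsGreatest {j | Vis (h₀ ++ t) j} k := by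
      obtain ⟨k, hk⟩ := hgr (h₀ ++ p)
      exact ⟨k, p, hp, hk⟩
    exact ⟨Nat.find hex, Nat.find_spec hex, fun j hj => Nat.find_min' hex hj⟩
  have hgreat : ∀ t ∈ T, IsGreatest {j | Vis (h₀ ++ (t₁ ++ t)) j} k := by
    intro t ht
    obtain ⟨j, hj⟩ := hgr (h₀ ++ (t₁ ++ t))
    have h1 := hmin j ⟨_, hT _ ht₁ _ ht, hj⟩
    have h2 : j ≤ k := hk.2 (hmono _ t ht j (by simpa using hj.1))
    rwa [le_antisymm h1 h2]
  have hstep : ∀ t ∈ T, ∃ x ∈ T, (∃ a b, x = a ++ b ∧ a ≠ [] ∧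
      B.priority (B.conf (h₀ ++ (t₁ ++ t) ++ a)).1 = k) ∧
      ∃ τ, if Even k then A.ReachNonfinal x (q, []) (q, τ) else A.ReachFinal x (q, []) (q, τ) := by
    intro t ht
    split_ifs with hev
    -- Even `k`: meet `k`, then close the block so that none of its steps is final.
    · obtain ⟨s, hs, a, b, rfl, ha, hk⟩ := (hgreat t ht).1
      obtain ⟨s', τ, h1, h2⟩ := hclose _ hs
      exact ⟨_, h1, ⟨a, b ++ s', by simp, ha, hk⟩, τ, h2⟩
    -- Odd `k`: the block begins with `p`, which shows a final step, and `k` is still visible after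
    -- `p`.
    · obtain ⟨s, hs, a, b, rfl, ha, hk⟩ := (hgreat (t ++ p) (hT _ ht _ hp)).1
      obtain ⟨τ, hτ⟩ := hfin
      obtain ⟨τ', hτ'⟩ := hreach _ hs
      exact ⟨_, hT _ hp _ hs, ⟨p ++ a, b, by simp, by simp [ha], by simpa using hk⟩, _,
        hτ.comp hτ'⟩
  choose! f hf using hstep
  let S : ℕ → List (VPLetter C I R) := fun n => Nat.rec p (fun _ t => t ++ f t) n
  have hS : ∀ n, S n ∈ T := by
    intro n
    induction n with
    | zero => exact hp
    | succ n ih => exact hT _ ih _ (hf _ ih).1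
  let H : ℕ → List (VPLetter C I R) := fun n => h₀ ++ (t₁ ++ S n)
  have hHs : ∀ n, H (n + 1) = H n ++ f (S n) := fun n => by simp [H, S]
  have hne : ∀ n, f (S n) ≠ [] := by
    intro n
    obtain ⟨a, b, h1, h2, -⟩ := (hf _ (hS n)).2.1
    rw [h1]
    simp [h2]
  obtain ⟨α, hα⟩ := exists_limit_word H fun n => ⟨_, hne n, hHs n⟩
  let L : ℕ → ℕ := fun n => (H n).length
  replace hα : ∀ n, segment α 0 (L n) = H n := hα
  have hL : ∀ n, L (n + 1) = L n + (f (S n)).length := fun n => by simp [L, hHs]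
  have hLpos : ∀ n, 0 < (f (S n)).length := fun n => List.length_pos_iff.2 (hne n)
  have hLmono : StrictMono L := strictMono_nat_of_lt_succ fun n => by
    have := hL n
    have := hLpos n
    omega
  have hLlt : ∀ n, L n < L (n + 1) := fun n => hLmono (Nat.lt_succ_self n)
  have hseg : ∀ n, segment α (L n) (L (n + 1)) = f (S n) := by
    intro n
    have h1 := segment_append α (Nat.zero_le _) (hLlt n).le
    rw [hα n, hα (n + 1), hHs] at h1
    exact List.append_cancel_left h1
  have hloc : ∀ j m, L j < m → ∃ l, j ≤ l ∧ L l < m ∧ m ≤ L (l + 1) := by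
    intro j m hm
    induction m with
    | zero => omega
    | succ m ih =>
      rcases (Nat.lt_succ_iff.1 hm).eq_or_lt with h | h
      · exact ⟨j, le_rfl, by omega, by have := hLlt j; omega⟩
      · obtain ⟨l, h1, h2, h3⟩ := ih h
        rcases h3.eq_or_lt with h4 | h4
        · exact ⟨l + 1, by omega, by omega, by have := hLlt (l + 1); omega⟩
        · exact ⟨l, h1, by omega, by omega⟩
  have hreach' : ∀ t ∈ T, ∃ τ, A.Reach (h₀ ++ t) (A.init, []) (q, τ) := by
    intro t ht
    obtain ⟨τ, hτ⟩ := hreach t ht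
    exact ⟨_, hh₀.comp hτ⟩
  obtain ⟨ρ, hρ⟩ : ∃ ρ, A.IsRun α ρ := by
    refine exists_isRun_of_reach fun n => ?_
    obtain ⟨τ, hτ⟩ := hreach' (t₁ ++ S n) (hT _ ht₁ _ (hS n))
    refine ⟨L n, (q, τ), hLmono.le_apply, ?_⟩
    rw [hα]
    exact hτ
  obtain ⟨ρ', hρ', -⟩ := hρ.exists_isRun B.toDVPMachine
  -- the parity automaton
  have hB : α ∈ B.language ↔ Even k := by
    have hg : IsGreatest {p : ℕ | ∃ᶠ n in atTop, B.priority (ρ' n).1 = p} k := by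
      constructor
      · refine Filter.frequently_atTop.2 fun n => ?_
        obtain ⟨a, b, h1, h2, h3⟩ := (hf _ (hS n)).2.1
        refine ⟨L n + a.length, by have := hLmono.le_apply (x := n); omega, ?_⟩
        rw [← h3, ← hρ'.conf_eq]
        congr 3
        rw [← segment_append α (Nat.zero_le (L n)) (by omega), hα]
        congr 1
        have h4 := segment_append α (l := L n) (m := L n + a.length) (n := L (n + 1)) (by omega)
          (by rw [hL, h1]; simp)
        rw [hseg, h1] at h4
        exact List.append_inj_left h4 (by simp)
      · intro j hj
        obtain ⟨m, hm, rfl⟩ := Filter.frequently_atTop.1 hj (L 0 + 1)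
        obtain ⟨l, -, h2, h3⟩ := hloc 0 m hm
        refine (hgreat _ (hS l)).2 ⟨_, (hf _ (hS l)).1, segment α (L l) m,
          segment α m (L (l + 1)), ?_, ?_, ?_⟩
        · rw [segment_append α h2.le h3, hseg]
        · intro h
          have := congrArg List.length h
          simp at this
          omega
        · rw [← hρ'.conf_eq, ← segment_append α (Nat.zero_le (L l)) h2.le, hα]
    constructor
    · rintro ⟨ρ'', h, j, hj, hj'⟩
      rw [hρ'.unique h] at hg
      rwa [hg.unique hj']
    · intro hk
      exact ⟨ρ', hρ', k, hk, hg⟩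
  -- the stair automaton
  have hconf : ∀ n, ∃ s, ρ (L n) = (q, s) := by
    intro n
    obtain ⟨τ, hτ⟩ := hreach' (t₁ ++ S n) (hT _ ht₁ _ (hS n))
    exact ⟨τ, hρ.eq_of_reach (Nat.zero_le _) (hα n) hρ.1 hτ⟩
  choose s hs using hconf
  have hheight : ∀ l i, i ≤ L (l + 1) - L l → (s l).length ≤ (ρ (L l + i)).2.length := by
    intro l i hi
    obtain ⟨τ, ρ₁, hρ₁⟩ := hreach _ (hf _ (hS l)).1
    have h1 := hρ₁.lift (s l)
    rw [List.nil_append] at h1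
    rw [hρ.eq_of_isFinRun (hLlt l).le (hseg l) (hs l) h1 i hi]
    simp
  have hsmono : Monotone fun n => (s n).length := monotone_nat_of_le_succ fun n => by
    have := hheight n (L (n + 1) - L n) le_rfl
    have h1 := hL n
    rw [show L n + (L (n + 1) - L n) = L (n + 1) by omega, hs (n + 1)] at this
    exact this
  have hbelow : ∀ j m, L j ≤ m → (s j).length ≤ (ρ m).2.length := by
    intro j m hm
    rcases hm.eq_or_lt with rfl | hm
    · rw [hs]
    · obtain ⟨l, h1, h2, h3⟩ := hloc j m hm
      have := hheight l (m - L l) (by omega)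
      rw [show L l + (m - L l) = m by omega] at this
      exact (hsmono h1).trans this
  have hA : α ∈ A.language ↔ ¬ Even k := by
    constructor
    · rintro ⟨ρ₁, h, hfr⟩ hk
      rw [← hρ.unique h] at hfr
      obtain ⟨m, hm, hst, hmF⟩ := Filter.frequently_atTop.1 hfr (L 0 + 1)
      obtain ⟨l, -, h2, h3⟩ := hloc 0 m hm
      obtain ⟨τ, hτ⟩ := (hf _ (hS l)).2.2
      rw [if_pos hk] at hτ
      have hτ' := hτ.lift (s l)
      rw [List.nil_append] at hτ'
      obtain ⟨ρ₂, hρ₂, -, hF⟩ := hτ'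
      have he := hρ.eq_of_isFinRun (hLlt l).le (hseg l) (hs l) hρ₂
      have hL' := hL l
      -- A step of the infinite run is in particular a step of the block that contains it, and the
      -- block has no final step.
      refine hF (m - L l) ⟨by omega, fun i h4 h5 => ?_⟩ ?_
      · rw [← he i (by omega), ← he _ (by omega)]
        have := hst (L l + i) (by omega)
        rwa [show L l + (m - L l) = m by omega]
      · rwa [← he _ (by omega), show L l + (m - L l) = m by omega]
    · intro hk
      refine ⟨ρ, hρ, Filter.frequently_atTop.2 fun n => ?_⟩
      obtain ⟨τ, hτ⟩ := (hf _ (hS n)).2.2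
      rw [if_neg hk] at hτ
      have hτ' := hτ.lift (s n)
      rw [List.nil_append] at hτ'
      obtain ⟨ρ₂, hρ₂, -, i, hi, hF⟩ := hτ'
      have he := hρ.eq_of_isFinRun (hLlt n).le (hseg n) (hs n) hρ₂
      have hL' := hL n
      have hi1 := hi.1
      -- A step of a block remains a step of the whole run, because later blocks never go below the
      -- height at which this block ends.
      refine ⟨L n + i, by have := hLmono.le_apply (x := n); omega, fun m hm => ?_, ?_⟩
      · rw [he i (by omega)]
        rcases le_or_gt m (L (n + 1)) with h4 | h4
        · have h5 := hi.2 (m - L n) (by omega) (by omega)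
          rw [← he (m - L n) (by omega), show L n + (m - L n) = m by omega] at h5
          exact h5
        · have h5 := hi.2 _ hi.1 le_rfl
          have h6 := hbelow (n + 1) m h4.le
          rw [← he (f (S n)).length (by omega), ← hL, hs (n + 1)] at h5
          exact h5.trans h6
      · rwa [he i (by omega)]
  intro hAB
  rw [hAB, hA] at hB
  by_cases hk : Even k <;> simp [hk] at hB

theorem _root_.DVPMachine.Reach.comp_reachFinal {u v : List (VPLetter C I R)} {p q r : Q}
    {σ τ : List Γ} (h₁ : A.Reach u (p, []) (q, σ)) (h₂ : A.ReachFinal v (q, []) (r, τ)) :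
    A.ReachFinal (u ++ v) (p, []) (r, τ ++ σ) := by
  obtain ⟨ρ₁, h₁⟩ := h₁
  have h₂' := h₂.lift σ
  rw [List.nil_append] at h₂'
  obtain ⟨ρ₂, h₂, -, n, hn, f⟩ := h₂'
  have hm : ρ₁ u.length = ρ₂ 0 := by rw [h₁.2.1, h₂.1]
  have hn1 := hn.1
  refine ⟨_, h₁.glue h₂, fun i hi => by simp, u.length + n, ⟨by simp; omega, fun m h1 h2 => ?_⟩, ?_⟩
  · obtain ⟨j, rfl⟩ := Nat.exists_eq_add_of_le (show u.length ≤ m by omega)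
    rw [glue_right hm, glue_right hm]
    exact hn.2 j (by omega) (by simp at h2; omega)
  · rwa [glue_right hm]

theorem reach_flatten_replicate {M : DVPMachine C I R Q Γ} {q : Q} {σ : List Γ}
    {y : List (VPLetter C I R)} (h : M.Reach y (q, σ) (q, [])) (m : ℕ) :
    M.Reach (List.replicate m y).flatten (q, (List.replicate m σ).flatten) (q, []) := by
  induction m with
  | zero => exact Reach.refl _
  | succ m ih =>
    simp only [List.replicate_succ, List.flatten_cons]
    exact (h.lift _).append ih

/-! ### Necessity: burying final steps by means of the forbidden pattern. -/

variable {q q' q'' : Q} {u v w x y z : List (VPLetter C I R)} {σ σ' : List Γ}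

theorem IsForbiddenPattern.rising (h : A.IsForbiddenPattern q q' q'' u v w x y z σ σ') :
    Rising u := by
  have hu : u ≠ [] := by
    rintro rfl
    obtain ⟨ρ, h1, -, n, h2, h3⟩ := h.run_u
    obtain rfl : n = 0 := by simpa using h2.1
    rw [h1.1] at h3
    exact h.q_nonfinal h3
  refine ⟨hu, fun a b hab ha => ?_⟩
  -- If nothing follows the prefix, then `u` is the whole minimally well-matched word. Its only
  -- steps are its two ends, both in the nonfinal state `q`, against `run_u`.
  by_cases hb : b ++ v ++ w ++ x ++ y ++ z = []
  · exfalso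
    simp only [List.append_eq_nil_iff] at hb
    obtain ⟨⟨⟨⟨⟨rfl, rfl⟩, rfl⟩, rfl⟩, rfl⟩, rfl⟩ := hb
    have hm := h.minWellMatched
    simp only [List.append_nil] at hm hab
    have h0 := h.run_u.reach.height_eq
    simp only [List.length_nil, Nat.cast_zero, zero_add, hm.height_eq, Nat.cast_eq_zero] at h0
    obtain ⟨ρ, h1, -, n, h2, h3⟩ := h.run_u
    refine (reachNonfinal_of_interior h.run_u.reach h.q_nonfinal h.q_nonfinal fun a b e h1 h2 => ?_
      : A.ReachNonfinal u (q, []) (q, σ)).elim fun ρ' h' => h'.2.2 n ?_ ?_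
    · have := hm.one_le e h1 h2
      simp [h0]
      omega
    · refine ⟨h2.1, fun m h4 h5 => ?_⟩
      rw [h'.1.unique h1 _ h2.1, h'.1.unique h1 _ h5]
      exact h2.2 m h4 h5
    · rwa [h'.1.unique h1 _ h2.1]
  · exact h.minWellMatched.one_le (w := b ++ v ++ w ++ x ++ y ++ z) (by rw [hab]; simp) ha hb

theorem IsForbiddenPattern.falling (h : A.IsForbiddenPattern q q' q'' u v w x y z σ σ') :
    Falling z := by
  have hu := h.rising
  have h1 := hu.2 u [] (by simp) hu.1
  have h2 := h.run_u.reach.height_eq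
  have h3 := h.run_z.height_eq
  refine ⟨?_, fun a b hab hb => ?_⟩
  · rintro rfl
    simp at h2 h3
    omega
  · have h4 := h.minWellMatched.one_le (v := u ++ v ++ w ++ x ++ y ++ a) (w := b)
      (by rw [hab]; simp) (by simp [hu.1]) hb
    have h5 := h.minWellMatched.height_eq
    rw [hab] at h5
    simp at h4 h5
    omega

/-- A word that keeps all steps nonfinal can be embedded into the pattern. -/
theorem IsForbiddenPattern.embed (h : A.IsForbiddenPattern q q' q'' u v w x y z σ σ') {m : ℕ}
    {t : List (VPLetter C I R)}
    (ht : A.ReachNonfinal t (q', []) (q', (List.replicate m σ').flatten)) :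
    A.ReachNonfinal (w ++ (u ++ (v ++ t ++ w ++ x ++ (List.replicate (m + 1) y).flatten) ++ z))
      (q', []) (q', σ') := by
  have hM : A.Reach (v ++ t ++ w ++ x ++ (List.replicate (m + 1) y).flatten) (q, []) (q'', []) := by
    have h1 := ((h.run_v.reach.comp ht.reach).comp h.run_w.reach).append
      (by simpa using h.run_x.lift _)
    refine h1.append ?_
    simpa [List.replicate_succ] using reach_flatten_replicate h.run_y (m + 1)
  have hU : A.Reach (u ++ (v ++ t ++ w ++ x ++ (List.replicate (m + 1) y).flatten) ++ z)
      (q, []) (q', []) :=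
    (h.run_u.reach.comp hM).append (by simpa using h.run_z)
  have hh := hM.height_eq
  have h2 := h.run_u.reach.height_eq
  have h3 := h.run_z.height_eq
  have hmin := minWellMatched_of_rising_falling h.rising hM.nonNeg
    (by simp only [List.length_nil] at hh; omega) h.falling (by simp at h2 h3; omega)
  refine h.run_w.comp (τ := []) (reachNonfinal_of_interior hU h.q_nonfinal h.q'_nonfinal
    fun a b e h1 h2 => ?_)
  have := hmin.one_le e h1 h2
  simp
  omega

/-- Arbitrary mixtures of the harmless loops in `N` and the loop `p` with a final step. By induction
from the right end, each of them can be completed to a word of `N`. -/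
inductive Continuation (N : Set (List (VPLetter C I R))) (p : List (VPLetter C I R)) :
    List (VPLetter C I R) → Prop
  | nil : Continuation N p []
  | mem {t s : List (VPLetter C I R)} : t ∈ N → Continuation N p s → Continuation N p (t ++ s)
  | cons {s : List (VPLetter C I R)} : Continuation N p s → Continuation N p (p ++ s)

theorem Continuation.append {N : Set (List (VPLetter C I R))} {p s t : List (VPLetter C I R)}
    (hs : Continuation N p s) (ht : Continuation N p t) : Continuation N p (s ++ t) := by
  induction hs with
  | nil => exact ht
  | mem h _ ih => rw [List.append_assoc]; exact .mem h ih
  | cons _ ih => rw [List.append_assoc]; exact .cons ih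

theorem IsForbiddenPattern.language_ne (h : A.IsForbiddenPattern q q' q'' u v w x y z σ σ')
    (hq : A.IsReachable q') {Q' Γ' : Type*} [Finite Q'] (B : ParityDVPA C I R Q' Γ') :
    B.language ≠ A.language := by
  let N : Set (List (VPLetter C I R)) :=
    {t | ∃ m, A.ReachNonfinal t (q', []) (q', (List.replicate m σ').flatten)}
  let p := w ++ u ++ v
  have hN : ∀ s ∈ N, ∀ t ∈ N, s ++ t ∈ N := by
    rintro s ⟨m, hs⟩ t ⟨n, ht⟩
    refine ⟨n + m, ?_⟩
    rw [List.replicate_add, List.flatten_append]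
    exact hs.comp ht
  have hp : ∃ τ, A.ReachFinal p (q', []) (q', τ) :=
    ⟨_, by simpa [p] using h.run_w.reach.comp_reachFinal (h.run_u.comp h.run_v.reach)⟩
  have hNT : ∀ t ∈ N, Continuation N p t := fun t ht => by
    simpa using Continuation.mem ht .nil
  refine language_ne_of_continuations B {t | Continuation N p t} q' p
    (fun s hs t ht => hs.append ht) (by simpa using Continuation.cons .nil)
    (by simp [p, h.rising.1]) ?_ hp ?_ hq
  · intro t ht
    induction ht with
    | nil => exact ⟨[], Reach.refl _⟩
    | mem h _ ih =>
      obtain ⟨m, h⟩ := h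
      obtain ⟨τ, hτ⟩ := ih
      exact ⟨_, h.reach.comp hτ⟩
    | cons _ ih =>
      obtain ⟨τ, hτ⟩ := ih
      obtain ⟨τ', hτ'⟩ := hp
      exact ⟨_, hτ'.reach.comp hτ⟩
  · suffices H : ∀ t, Continuation N p t → ∃ s, t ++ s ∈ N by
      intro t ht
      obtain ⟨s, hs⟩ := H t ht
      obtain ⟨m, hm⟩ := id hs
      exact ⟨s, _, hNT _ hs, hm⟩
    intro t ht
    induction ht with
    | nil => exact ⟨[], 0, ReachNonfinal.refl h.q'_nonfinal⟩
    | mem h _ ih =>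
      obtain ⟨s, hs⟩ := ih
      exact ⟨s, by rw [List.append_assoc]; exact hN _ h _ hs⟩
    | cons _ ih =>
      obtain ⟨s, m, hs⟩ := ih
      -- The completed continuation pushes `m` copies of `σ'` and the following `w` one more, so `y`
      -- is read `m + 1` times. What remains is the single `σ'` pushed by the `w` that begins `p`.
      refine ⟨s ++ w ++ x ++ (List.replicate (m + 1) y).flatten ++ z, 1, ?_⟩
      have := h.embed hs
      simpa [p] using this

end StairBuchiDVPA

/-! ### Climbs and anchors, and how they produce a forbidden pattern. -/

namespace StairBuchiDVPA

open VPLetter DVPMachine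

variable {C I R Q Γ : Type*} (A : StairBuchiDVPA C I R Q Γ)

/-- Some word leads from `x` with stack `σ` to `y` with the empty stack. -/
def CloseTo (σ : List Γ) (x y : Q) : Prop := ∃ u, A.Reach u (x, σ) (y, [])

/-- From every state in `V` one can pop `σ` and arrive in `X`. -/
def MapsTo (V : Set Q) (σ : List Γ) (X : Set Q) : Prop := ∀ x ∈ V, ∃ y ∈ X, A.CloseTo σ x y

/-- A climb from `p` to `b` without final states on steps such that the set `Z` can be reached
from `V` by popping what has been pushed. -/
def Climb (p : Q) (Z : Set Q) (b : Q) (V : Set Q) : Prop :=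
  ∃ w σ, A.ReachNonfinal w (p, []) (b, σ) ∧ A.MapsTo V σ Z

/-- The states from which one can get to a state in `X` by popping `Z` in the last move. -/
def popSet (Z : Γ) (X : Set Q) : Set Q :=
  {x | ∃ x' r, A.CloseTo [] x x' ∧ A.retStep x' Z r ∈ X}

variable {A}

theorem CloseTo.refl (x : Q) : A.CloseTo [] x x := ⟨[], Reach.refl _⟩

theorem CloseTo.trans {σ τ : List Γ} {x y z : Q} (h₁ : A.CloseTo σ x y) (h₂ : A.CloseTo τ y z) :
    A.CloseTo (σ ++ τ) x z := by
  obtain ⟨u, hu⟩ := h₁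
  obtain ⟨v, hv⟩ := h₂
  exact ⟨u ++ v, (hu.lift τ).append hv⟩

theorem CloseTo.of_reach {u : List (VPLetter C I R)} {σ : List Γ} {x y z : Q}
    (h₁ : A.Reach u (x, []) (y, σ)) (h₂ : A.CloseTo σ y z) : A.CloseTo [] x z := by
  obtain ⟨v, hv⟩ := h₂
  exact ⟨u ++ v, h₁.append hv⟩

theorem MapsTo.trans {V X Y : Set Q} {σ τ : List Γ} (h₁ : A.MapsTo V σ X) (h₂ : A.MapsTo X τ Y) :
    A.MapsTo V (σ ++ τ) Y := by
  intro x hx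
  obtain ⟨y, hy, h⟩ := h₁ x hx
  obtain ⟨z, hz, h'⟩ := h₂ y hy
  exact ⟨z, hz, h.trans h'⟩

theorem mapsTo_nil {V X : Set Q} (h : V ⊆ X) : A.MapsTo V [] X := fun x hx => ⟨x, h hx, .refl x⟩

theorem mapsTo_popSet (Z : Γ) (X : Set Q) : A.MapsTo (A.popSet Z X) [Z] X := by
  rintro x ⟨x', r, h, h'⟩
  refine ⟨_, h', h.trans (σ := []) (τ := [Z]) ⟨[ret r], Reach.single ?_⟩⟩
  rfl

theorem popSet_mono (Z : Γ) {X Y : Set Q} (h : X ⊆ Y) : A.popSet Z X ⊆ A.popSet Z Y := by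
  rintro x ⟨x', r, h1, h2⟩
  exact ⟨x', r, h1, h h2⟩

theorem Climb.trans {p b c : Q} {Z V U : Set Q} (h₁ : A.Climb p Z b V) (h₂ : A.Climb b V c U) :
    A.Climb p Z c U := by
  obtain ⟨w, σ, hw, hm⟩ := h₁
  obtain ⟨w', σ', hw', hm'⟩ := h₂
  exact ⟨_, _, hw.comp hw', hm'.trans hm⟩

theorem climb_self {p : Q} {Z V : Set Q} (hp : p ∉ A.final) (h : V ⊆ Z) : A.Climb p Z p V :=
  ⟨[], [], ReachNonfinal.refl hp, mapsTo_nil h⟩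

theorem Climb.not_final {p b : Q} {Z V : Set Q} (h : A.Climb p Z b V) : p ∉ A.final := by
  obtain ⟨w, σ, hw, -⟩ := h
  exact hw.left

/-- A way to get back from `x` with the stack `σ` to the climb from `b` to the state `p` with the
stack `σ`: the upper part `σ₁` of `σ` is popped, and the state `y` reached then can climb to `b`
again. -/
structure IsAnchor (A : StairBuchiDVPA C I R Q Γ) (b : Q) (V : Set Q) (p : Q) (σ : List Γ) (x : Q)
    (fin : Prop) (σ₁ σ₂ σ₃ : List Γ) (a y : Q) (X : Set Q)
    (w₁ w₂ w₃ w₄ : List (VPLetter C I R)) : Prop where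
  stack_eq : σ = σ₁ ++ σ₂
  run₁ : A.ReachNonfinal w₁ (b, []) (a, σ₂)
  rising : Rising w₂
  run₂ : A.Reach w₂ (a, []) (p, σ₁)
  run₂_final : fin → A.ReachFinal w₂ (a, []) (p, σ₁)
  falling : Falling w₃
  run₃ : A.Reach w₃ (x, σ₁) (y, [])
  run₄ : A.ReachNonfinal w₄ (y, []) (b, σ₃)
  mapsTo₁ : A.MapsTo V σ₃ X
  mapsTo₂ : A.MapsTo X σ₂ V

def Anchored (A : StairBuchiDVPA C I R Q Γ) (b : Q) (V : Set Q) (p : Q) (σ : List Γ) (x : Q)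
    (fin : Prop) : Prop :=
  ∃ σ₁ σ₂ σ₃ a y X w₁ w₂ w₃ w₄, IsAnchor A b V p σ x fin σ₁ σ₂ σ₃ a y X w₁ w₂ w₃ w₄

/-- Two iterates coincide, say those with exponents `m` and `m + d + 1`. The exponent `(m + 1) * (d
+ 1)` is a multiple of the period beyond the preperiod, and being positive it has the form `k + 1`.
-/
theorem exists_iterate_idempotent [Finite Q] (g : Q → Q) :
    ∃ k, ∀ x, g^[k + 1] (g^[k + 1] x) = g^[k + 1] x := by
  obtain ⟨m, n, hmn, h⟩ := Finite.exists_ne_map_eq_of_infinite fun n : ℕ => g^[n]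
  wlog hlt : m < n generalizing m n
  · exact this n m hmn.symm h.symm (by omega)
  obtain ⟨d, rfl⟩ := Nat.exists_eq_add_of_lt hlt
  have h1 : ∀ j, m ≤ j → ∀ i x, g^[j + i * (d + 1)] x = g^[j] x := by
    intro j hj i x
    induction i with
    | zero => simp
    | succ i ih =>
      rw [← ih]
      obtain ⟨e, rfl⟩ := Nat.exists_eq_add_of_le hj
      have h2 := congrFun h (g^[e + i * (d + 1)] x)
      rw [← Function.iterate_add_apply, ← Function.iterate_add_apply] at h2
      rw [show m + e + (i + 1) * (d + 1) = m + d + 1 + (e + i * (d + 1)) by ring, ← h2, add_assoc]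
  refine ⟨(m + 1) * (d + 1) - 1, fun x => ?_⟩
  have h3 : (m + 1) * (d + 1) - 1 + 1 = (m + 1) * (d + 1) :=
    Nat.sub_add_cancel (Nat.mul_pos (by omega) (by omega))
  rw [h3, ← Function.iterate_add_apply]
  exact h1 _ (by nlinarith) _ x

theorem reachNonfinal_flatten_replicate {q : Q} {σ : List Γ} {y : List (VPLetter C I R)}
    (h : A.ReachNonfinal y (q, []) (q, σ)) (m : ℕ) :
    A.ReachNonfinal (List.replicate m y).flatten (q, []) (q, (List.replicate m σ).flatten) := by
  induction m with
  | zero => exact .refl h.left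
  | succ m ih =>
    rw [List.replicate_succ' (a := y), List.replicate_succ (a := σ)]
    simpa using ih.comp h

theorem closeTo_iterate {O : Set Q} {σ : List Γ} {g : Q → Q} (hg : ∀ x ∈ O, g x ∈ O)
    (h : ∀ x ∈ O, A.CloseTo σ x (g x)) (m : ℕ) {x : Q} (hx : x ∈ O) :
    g^[m] x ∈ O ∧ A.CloseTo (List.replicate m σ).flatten x (g^[m] x) := by
  induction m generalizing x with
  | zero => exact ⟨hx, .refl x⟩
  | succ m ih =>
    obtain ⟨h1, h2⟩ := ih (hg x hx)
    refine ⟨h1, ?_⟩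
    rw [List.replicate_succ, List.flatten_cons]
    exact (h x hx).trans h2

/-- The maps on `O` obtained by pushing along a loop at `b` and popping again are closed under
composition; take `g₀` with the smallest image. The anchor of `g₀ b` closes up to a loop at `b`
without final steps. Some power of its pop map `g` is idempotent, and minimality gives a fixed point
`q₀` of this power with `g₀ q₀ = g₀ b`. So the loop can be popped arbitrarily often before the stack
of `g₀` leads to the state `g₀ b` that the anchor requires. -/
theorem hasForbiddenPattern_of_anchored [Finite Q] {b : Q} {V : Set Q} {σ : List Γ} (hb : b ∈ V)
    (h : ∀ x ∈ V, A.Anchored b V b σ x True) : A.HasForbiddenPattern := by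
  classical
  let O : Set Q := {x | x ∈ V ∧ A.CloseTo [] b x}
  let G : Set (Q → Q) := {g | ∃ u τ, A.Reach u (b, []) (b, τ) ∧
    ∀ x ∈ O, g x ∈ O ∧ A.CloseTo τ x (g x)}
  have hbO : b ∈ O := ⟨hb, .refl b⟩
  have hbF : b ∉ A.final := by
    obtain ⟨_, _, _, _, _, _, _, _, _, _, h⟩ := h b hb
    exact h.run₁.left
  have hid : id ∈ G := ⟨[], [], Reach.refl _, fun x hx => ⟨hx, .refl x⟩⟩
  have hcomp : ∀ g ∈ G, ∀ g' ∈ G, g' ∘ g ∈ G := by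
    rintro g ⟨u, τ, hu, hg⟩ g' ⟨u', τ', hu', hg'⟩
    exact ⟨_, _, hu'.comp hu, fun x hx =>
      ⟨(hg' _ (hg x hx).1).1, (hg x hx).2.trans (hg' _ (hg x hx).1).2⟩⟩
  obtain ⟨g₀, hg₀, hmin⟩ : ∃ g₀ ∈ G, ∀ g ∈ G, (g₀ '' O).ncard ≤ (g '' O).ncard := by
    have hex : ∃ n, ∃ g ∈ G, (g '' O).ncard = n := ⟨_, id, hid, rfl⟩
    obtain ⟨g, hg, h1⟩ := Nat.find_spec hex
    exact ⟨g, hg, fun g' hg' => h1 ▸ Nat.find_min' hex ⟨g', hg', rfl⟩⟩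
  obtain ⟨u₀, τ₀, hu₀, hτ₀⟩ := id hg₀
  obtain ⟨σ₁, σ₂, σ₃, a, y, X, w₁, w₂, w₃, w₄, ha⟩ := h _ (hτ₀ b hbO).1.1
  obtain ⟨c₀, hc₀⟩ := (hτ₀ b hbO).2
  have hu₂ : A.Reach w₂ (a, []) (b, σ₁) := ha.run₂
  have hend : ∀ m, A.Reach m (b, []) (g₀ b, []) →
      MinWellMatched (w₂ ++ m ++ w₃) ∧ A.Reach (w₂ ++ m ++ w₃) (a, []) (y, []) := by
    intro m hm
    have h1 := hm.height_eq
    have h2 := hu₂.height_eq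
    have h3 := ha.run₃.height_eq
    simp only [List.length_nil] at h1 h2 h3
    refine ⟨minWellMatched_of_rising_falling ha.rising hm.nonNeg (by omega) ha.falling
      (by push_cast at *; omega), ?_⟩
    exact (hu₂.comp hm).append ha.run₃
  -- the return to the anchor
  have hv : A.ReachNonfinal (w₂ ++ (u₀ ++ c₀) ++ w₃) (a, []) (y, []) := by
    obtain ⟨h1, h2⟩ := hend (u₀ ++ c₀) (hu₀.append hc₀)
    refine reachNonfinal_of_interior h2 ha.run₁.right ha.run₄.left fun s t e hs ht => ?_
    have := h1.one_le e hs ht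
    simp only [List.length_nil]
    omega
  generalize hvdef : w₂ ++ (u₀ ++ c₀) ++ w₃ = v at hv
  have hν : A.ReachNonfinal (w₁ ++ v ++ w₄) (b, []) (b, σ₃ ++ σ₂) := (ha.run₁.comp hv).comp ha.run₄
  generalize w₁ ++ v ++ w₄ = ν at hν
  -- The state between popping `σ₃` and popping `σ₂` is kept, since the state `q''` of the pattern
  -- is of this kind.
  have hgex : ∀ x, ∃ m x', x ∈ V → A.CloseTo σ₃ x m ∧ A.CloseTo σ₂ m x' ∧ x' ∈ V := by
    intro x
    by_cases hx : x ∈ V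
    · obtain ⟨m, hm, h1⟩ := ha.mapsTo₁ x hx
      obtain ⟨x', hx', h2⟩ := ha.mapsTo₂ m hm
      exact ⟨m, x', fun _ => ⟨h1, h2, hx'⟩⟩
    · exact ⟨x, x, fun h => absurd h hx⟩
  choose mid g hg using hgex
  have hgC : ∀ x ∈ O, A.CloseTo (σ₃ ++ σ₂) x (g x) := fun x hx =>
    (hg x hx.1).1.trans (hg x hx.1).2.1
  have hgO : ∀ x ∈ O, g x ∈ O := fun x hx =>
    ⟨(hg x hx.1).2.2, .of_reach hν.reach (hx.2.trans (hgC x hx))⟩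
  have hit := fun m {x} hx => closeTo_iterate (A := A) (x := x) hgO hgC m hx
  have hgG : ∀ m, g^[m] ∈ G := fun m =>
    ⟨_, _, (reachNonfinal_flatten_replicate hν m).reach, fun x hx => hit m hx⟩
  obtain ⟨k, hk⟩ := exists_iterate_idempotent g
  -- The image can only shrink, and minimality forbids that it does. Hence `g₀ b` is also attained
  -- from a point fixed by `g^[k + 1]`.
  have himg : (g₀ ∘ g^[k + 1]) '' O = g₀ '' O := by
    refine Set.eq_of_subset_of_ncard_le ?_ (hmin _ (hcomp _ (hgG _) _ hg₀)) (Set.toFinite _)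
    rintro _ ⟨x, hx, rfl⟩
    exact ⟨_, (hit (k + 1) hx).1, rfl⟩
  obtain ⟨x₁, hx₁, hx₁'⟩ : g₀ b ∈ (g₀ ∘ g^[k + 1]) '' O := himg ▸ ⟨b, hbO, rfl⟩
  obtain ⟨q₀, hq₀, hq₀g, hq₀'⟩ : ∃ q₀ ∈ O, g^[k + 1] q₀ = q₀ ∧ g₀ q₀ = g₀ b :=
    ⟨_, (hit (k + 1) hx₁).1, hk x₁, hx₁'⟩
  have hk₀ := hit k hq₀
  generalize hq₁ : g^[k] q₀ = q₁ at hk₀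
  have hgq₁ : g q₁ = q₀ := by rw [← hq₁, ← Function.iterate_succ_apply' g, hq₀g]
  obtain ⟨h1, h2, -⟩ := hg q₁ hk₀.1.1
  rw [hgq₁] at h2
  generalize mid q₁ = q'' at h1 h2
  have hloop := reachNonfinal_flatten_replicate hν k
  generalize (List.replicate k (σ₃ ++ σ₂)).flatten = σ' at hk₀ hloop
  generalize (List.replicate k ν).flatten = ν' at hloop
  obtain ⟨x₂, hx₂⟩ := hq₀.2
  obtain ⟨d₁, hd₁⟩ := hk₀.2.trans h1
  obtain ⟨d₂, hd₂⟩ := h2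
  obtain ⟨d₃, hd₃⟩ := (hτ₀ q₀ hq₀).2
  rw [hq₀'] at hd₃
  have hw : A.ReachNonfinal (w₄ ++ ν' ++ w₁) (y, []) (a, σ₂ ++ (σ' ++ σ₃)) :=
    (ha.run₄.comp hloop).comp ha.run₁
  have hx : A.Reach (v ++ w₄ ++ ν' ++ x₂ ++ d₁) (a, []) (q'', []) :=
    ((((hv.reach.comp ha.run₄.reach).comp hloop.reach).comp hx₂).append (by simpa using hd₁))
  have hy : A.Reach (d₂ ++ d₁) (q'', σ₂ ++ (σ' ++ σ₃)) (q'', []) := by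
    have := (hd₂.lift (σ' ++ σ₃)).append hd₁
    simpa using this
  have hM : A.Reach (u₀ ++ w₁ ++ v ++ (w₄ ++ ν' ++ w₁) ++ (v ++ w₄ ++ ν' ++ x₂ ++ d₁) ++
      (d₂ ++ d₁) ++ d₂ ++ d₃) (b, []) (g₀ b, []) := by
    have e1 := (((hu₀.comp ha.run₁.reach).comp hv.reach).comp hw.reach).comp hx
    have e2 := e1.append (by simpa using hy.lift (σ₂ ++ τ₀))
    have e3 := e2.append (by simpa using hd₂.lift τ₀)
    exact e3.append hd₃
  -- The final step lies in `w₂`. From `q''`, `d₂` pops `σ₂` and arrives at `q₀`; `d₁` pops `k`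
  -- loops and `σ₃` and comes back to `q''`. The last word pops `σ₂`, `τ₀` and `σ₁`, by way of `q₀`
  -- and `g₀ b`.
  refine ⟨a, y, q'', w₂ ++ u₀ ++ w₁, v, w₄ ++ ν' ++ w₁, v ++ w₄ ++ ν' ++ x₂ ++ d₁,
    d₂ ++ d₁, d₂ ++ d₃ ++ w₃, σ₂ ++ (τ₀ ++ σ₁), σ₂ ++ (σ' ++ σ₃),
    ha.run₁.right, ha.run₄.left, ?_, ?_, hv, hw, hx, hy, ?_⟩
  · simpa using (hend _ hM).1
  · exact ((ha.run₂_final trivial).comp hu₀).comp ha.run₁.reach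
  · have e1 := (hd₂.lift (τ₀ ++ σ₁)).append (by simpa using hd₃.lift σ₁)
    exact e1.append (by simpa using ha.run₃)

end StairBuchiDVPA

/-! ### Records of situations and their invariant. -/

namespace StairBuchiDVPA

open VPLetter DVPMachine

variable {C I R Q Γ : Type*} (A : StairBuchiDVPA C I R Q Γ)

/-- A record `(b, V, Y)`: the current climb has passed through the state `b` while the set `V` was
to be reached by pops, and from the states in `Y` one can get back to the part of the climb that
is equivalent to this situation. -/
abbrev Entry (Q : Type*) := Q × Set Q × Set Q

/-- The set to be reached by pops according to the topmost record. -/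
def target : List (Entry Q) → Set Q
  | [] => Set.univ
  | e :: _ => e.2.2

/-- The topmost record remains the current one when the state changes from `p` to `y`. -/
def Active (p : Q) (L : List (Entry Q)) (y : Q) : Prop :=
  p ∉ A.final ∧ ∃ e L', L = e :: L' ∧ A.Climb y (target L') e.1 e.2.1

open Classical in
/-- The records that remain valid in the state `y`. -/
noncomputable def kept (L : List (Entry Q)) (y : Q) : List (Entry Q) :=
  L.dropWhile fun e => decide (y ∉ e.2.2)

open Classical in
/-- The records after a change of the state from `p` to `y`. -/
noncomputable def updList (p : Q) (L : List (Entry Q)) (y : Q) : List (Entry Q) :=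
  if A.Active p L y then L
  else if y ∈ A.final then kept L y else (y, target (kept L y), ∅) :: kept L y

open Classical in
/-- The number of records that survive a change of the state from `p` to `y`. -/
noncomputable def updCount (p : Q) (L : List (Entry Q)) (y : Q) : ℕ :=
  if A.Active p L y then L.length else (kept L y).length

def pushEntry (Z : Γ) (e : Entry Q) : Entry Q := (e.1, e.2.1, A.popSet Z e.2.2)

/-- The records one level above. -/
def pushList (p : Q) (Z : Γ) : List (Entry Q) → List (Entry Q)
  | [] => []
  | e :: L => (e.1, e.2.1,
      A.popSet Z (e.2.2 ∪ {y | p ∉ A.final ∧ A.Climb y (target L) e.1 e.2.1})) ::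
      L.map (A.pushEntry Z)

/-- A word leading from `p` to `p'` with the new stack content `τ`, with steps only at the ends. -/
structure Move (p p' : Q) (w : List (VPLetter C I R)) (τ : List Γ) : Prop where
  reach : A.Reach w (p, []) (p', τ)
  nonfinal : p ∉ A.final → p' ∉ A.final → A.ReachNonfinal w (p, []) (p', τ)

def Saturated (X : Set Q) : Prop := ∀ x y, A.CloseTo [] x y → y ∈ X → x ∈ X

/-- Here `Z` is the target given by the records beneath. The first alternative of `cert` is a record
without final steps since its creation; as its situation has led to `(p, Z)`, being active means
that both are equivalent under climbs. In the second alternative the anchors contain a final step,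
and the record cannot be active. -/
structure EntryInv (p : Q) (Z : Set Q) (e : Entry Q) (act : Prop) : Prop where
  mem : e.1 ∈ e.2.1
  subset : e.2.2 ⊆ Z
  saturated : A.Saturated e.2.2
  cert : ∃ σ, A.MapsTo Z σ e.2.1 ∧
    (((∃ u, A.ReachNonfinal u (e.1, []) (p, σ)) ∧
        (∀ x ∈ e.2.2, A.Anchored e.1 e.2.1 p σ x False) ∧ (act ↔ A.Climb p Z e.1 e.2.1)) ∨
      (¬ act ∧ ∀ x ∈ e.2.2, A.Anchored e.1 e.2.1 p σ x True))

def RestInv (p : Q) : List (Entry Q) → Prop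
  | [] => True
  | e :: L => A.EntryInv p (target L) e False ∧ RestInv p L

/-- The invariant of the records in the state `p`. -/
def ListInv (p : Q) : List (Entry Q) → Prop
  | [] => p ∈ A.final
  | e :: L => A.EntryInv p (target L) e (p ∉ A.final) ∧ A.RestInv p L

def reps (L : List (Entry Q)) : List (Q × Set Q) := L.map fun e => (e.1, e.2.1)

variable {A}

theorem saturated_univ : A.Saturated Set.univ := fun _ _ _ _ => trivial

theorem saturated_popSet (Z : Γ) (X : Set Q) : A.Saturated (A.popSet Z X) := by
  rintro x y h ⟨x', r, h1, h2⟩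
  exact ⟨x', r, h.trans h1, h2⟩

theorem EntryInv.congr {p : Q} {Z : Set Q} {e : Entry Q} {act act' : Prop}
    (h : A.EntryInv p Z e act) (h' : act ↔ act') : A.EntryInv p Z e act' := by
  rwa [← propext h']

theorem Anchored.move {b p p' x : Q} {V : Set Q} {σ : List Γ} {fin fin' : Prop}
    {w : List (VPLetter C I R)} (h : A.Anchored b V p σ x fin) (hm : A.Move p p' w [])
    (hf : fin' → fin ∨ p' ∈ A.final) : A.Anchored b V p' σ x fin' := by
  obtain ⟨σ₁, σ₂, σ₃, a, y, X, w₁, w₂, w₃, w₄, h⟩ := h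
  refine ⟨σ₁, σ₂, σ₃, a, y, X, w₁, w₂ ++ w, w₃, w₄, h.stack_eq, h.run₁,
    h.rising.append hm.reach.nonNeg, h.run₂.comp hm.reach, fun hfin => ?_, h.falling, h.run₃,
    h.run₄, h.mapsTo₁, h.mapsTo₂⟩
  rcases hf hfin with h' | h'
  · exact (h.run₂_final h').comp hm.reach
  · exact reachFinal_of_right (h.run₂.comp hm.reach) h'

theorem exists_falling_of_mem_popSet {x : Q} {Z : Γ} {X : Set Q} (hx : x ∈ A.popSet Z X) :
    ∃ y ∈ X, ∃ w, A.Reach w (x, [Z]) (y, []) ∧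
      ∀ v, (v = [] ∨ Falling v) → Falling (w ++ v) := by
  obtain ⟨x', r, ⟨u, hu⟩, h⟩ := hx
  refine ⟨_, h, u ++ [ret r], (hu.lift [Z]).append (Reach.single rfl), fun v hv => ?_⟩
  have := hu.height_eq
  simp only [List.length_nil] at this
  simpa using falling_append_ret hu.nonNeg (by omega) r hv

theorem Anchored.push {b p p' x : Q} {V Y : Set Q} {σ : List Γ} {fin fin' : Prop} {c : C} {Z : Γ}
    (h : ∀ y ∈ Y, A.Anchored b V p σ y fin) (hx : x ∈ A.popSet Z Y)
    (hm : A.Move p p' [call c] [Z]) (hf : fin' → fin ∨ p' ∈ A.final) :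
    A.Anchored b V p' (Z :: σ) x fin' := by
  obtain ⟨y', hy, w, hw, hfall⟩ := exists_falling_of_mem_popSet hx
  obtain ⟨σ₁, σ₂, σ₃, a, y, X, w₁, w₂, w₃, w₄, h⟩ := h y' hy
  refine ⟨Z :: σ₁, σ₂, σ₃, a, y, X, w₁, w₂ ++ [call c], w ++ w₃, w₄, by simp [h.stack_eq], h.run₁,
    h.rising.append hm.reach.nonNeg, h.run₂.comp hm.reach, fun hfin => ?_, hfall _ (.inr h.falling),
    (hw.lift σ₁).append (by simpa using h.run₃), h.run₄, h.mapsTo₁, h.mapsTo₂⟩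
  rcases hf hfin with h' | h'
  · exact (h.run₂_final h').comp hm.reach
  · exact reachFinal_of_right (h.run₂.comp hm.reach) h'

/-- The source of all anchors: the call from `p` rises, the word up to the return popping `Z` falls,
and a climb leads back to `b`. It justifies the climbing states that `pushList` adds to the top
record. -/
theorem anchored_of_climb {b p p' x : Q} {V X : Set Q} {σ : List Γ} {fin : Prop} {c : C} {Z : Γ}
    {u : List (VPLetter C I R)} (hu : A.ReachNonfinal u (b, []) (p, σ)) (hσ : A.MapsTo X σ V)
    (hx : x ∈ A.popSet Z {y | A.Climb y X b V}) (hm : A.Move p p' [call c] [Z])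
    (hf : fin → p' ∈ A.final) : A.Anchored b V p' (Z :: σ) x fin := by
  obtain ⟨y, ⟨w₄, σ₃, hw₄, hσ₃⟩, w, hw, hfall⟩ := exists_falling_of_mem_popSet hx
  exact ⟨[Z], σ, σ₃, p, y, X, u, [call c], w, w₄, rfl, hu, rising_call c, hm.reach,
    fun hfin => reachFinal_of_right hm.reach (hf hfin), by simpa using hfall [] (.inl rfl), hw,
    hw₄, hσ₃, hσ⟩

/-- Common to moves on a level and to calls. If `p'` is final, a certificate of the first kind turns
into one of the second kind. If not, the move prolongs the climb, and a climb from `p'` back to the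
record yields one from `p`. -/
theorem EntryInv.step {p p' : Q} {Z Z' Y' : Set Q} {e : Entry Q} {act : Prop}
    {w : List (VPLetter C I R)} {τ : List Γ} (h : A.EntryInv p Z e act) (hm : A.Move p p' w τ)
    (hZ : A.MapsTo Z' τ Z) (hY : Y' ⊆ Z') (hsat : A.Saturated Y')
    (hanch : ∀ (σ : List Γ) (fin fin' : Prop), A.MapsTo Z σ e.2.1 →
      (∀ x ∈ e.2.2, A.Anchored e.1 e.2.1 p σ x fin) → (fin' → fin ∨ p' ∈ A.final) →
      (act → ¬ fin ∧ ∃ u, A.ReachNonfinal u (e.1, []) (p, σ)) →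
      ∀ x ∈ Y', A.Anchored e.1 e.2.1 p' (τ ++ σ) x fin') :
    A.EntryInv p' Z' (e.1, e.2.1, Y') (act ∧ A.Climb p' Z' e.1 e.2.1) := by
  obtain ⟨σ, hσ, hc⟩ := h.cert
  refine ⟨h.mem, hY, hsat, τ ++ σ, hZ.trans hσ, ?_⟩
  rcases hc with ⟨⟨u, hu⟩, ha, hact⟩ | ⟨hact, ha⟩
  · by_cases hp' : p' ∈ A.final
    · exact .inr ⟨fun h' => h'.2.not_final hp', hanch σ False True hσ ha (fun _ => .inr hp')
        fun _ => ⟨id, u, hu⟩⟩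
    · have hmn := hm.nonfinal hu.right hp'
      refine .inl ⟨⟨_, hu.comp hmn⟩, hanch σ False False hσ ha False.elim fun _ => ⟨id, u, hu⟩,
        And.right, fun h' => ⟨hact.2 ?_, h'⟩⟩
      exact Climb.trans ⟨w, τ, hmn, hZ⟩ h'
  · exact .inr ⟨fun h' => hact h'.1, hanch σ True True hσ ha (fun _ => .inl trivial)
      fun h' => absurd h' hact⟩

theorem EntryInv.move {p p' : Q} {Z : Set Q} {e : Entry Q} {act : Prop}
    {w : List (VPLetter C I R)} (h : A.EntryInv p Z e act) (hm : A.Move p p' w []) :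
    A.EntryInv p' Z e (act ∧ A.Climb p' Z e.1 e.2.1) :=
  h.step hm (mapsTo_nil subset_rfl) h.subset h.saturated
    fun _ _ _ _ ha hf _ x hx => (ha x hx).move hm hf

theorem RestInv.move {p p' : Q} {L : List (Entry Q)} {w : List (VPLetter C I R)}
    (h : A.RestInv p L) (hm : A.Move p p' w []) : A.RestInv p' L := by
  induction L with
  | nil => trivial
  | cons e L ih => exact ⟨(h.1.move hm).congr (by simp), ih h.2⟩

/-- Without records the target is everything, and then some return letter must exist to pop `Z` at
all. -/
theorem mapsTo_target_map [Nonempty R] (Z : Γ) (L : List (Entry Q)) :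
    A.MapsTo (target (L.map (A.pushEntry Z))) [Z] (target L) := by
  cases L with
  | nil =>
    intro x _
    obtain ⟨r⟩ := ‹Nonempty R›
    exact ⟨A.retStep x Z r, trivial, [ret r], Reach.single rfl⟩
  | cons e L => exact mapsTo_popSet Z _

theorem popSet_target_subset (Z : Γ) (L : List (Entry Q)) :
    A.popSet Z (target L) ⊆ target (L.map (A.pushEntry Z)) := by
  cases L with
  | nil => exact Set.subset_univ _
  | cons e L => exact subset_rfl

theorem RestInv.push [Nonempty R] {p p' : Q} {L : List (Entry Q)} {c : C} {Z : Γ}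
    (h : A.RestInv p L) (hm : A.Move p p' [call c] [Z]) :
    A.RestInv p' (L.map (A.pushEntry Z)) := by
  induction L with
  | nil => trivial
  | cons e L ih =>
    refine ⟨EntryInv.congr (h.1.step hm (mapsTo_target_map Z L)
      ((popSet_mono Z h.1.subset).trans (popSet_target_subset Z L)) (saturated_popSet Z _)
      fun σ fin fin' _ ha hf _ x hx => Anchored.push ha hx hm hf) (by simp), ih h.2⟩

theorem RestInv.saturated {p : Q} {L : List (Entry Q)} (h : A.RestInv p L) :
    A.Saturated (target L) := by
  cases L with
  | nil => exact saturated_univ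
  | cons e L => exact h.1.saturated

theorem Climb.mem {y b : Q} {Z V : Set Q} (h : A.Climb y Z b V) (hb : b ∈ V)
    (hZ : A.Saturated Z) : y ∈ Z := by
  obtain ⟨w, σ, hw, hm⟩ := h
  obtain ⟨z, hz, hz'⟩ := hm b hb
  exact hZ _ z (.of_reach hw.reach hz') hz

theorem EntryInv.push [Nonempty R] {p p' : Q} {e : Entry Q} {L : List (Entry Q)} {c : C} {Z : Γ}
    (h : A.EntryInv p (target L) e (p ∉ A.final)) (hL : A.RestInv p L)
    (hm : A.Move p p' [call c] [Z]) :
    A.EntryInv p' (target (L.map (A.pushEntry Z))) (e.1, e.2.1,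
        A.popSet Z (e.2.2 ∪ {y | p ∉ A.final ∧ A.Climb y (target L) e.1 e.2.1}))
      (p ∉ A.final ∧ A.Climb p' (target (L.map (A.pushEntry Z))) e.1 e.2.1) := by
  refine h.step hm (mapsTo_target_map Z L) ?_ (saturated_popSet Z _) ?_
  · refine (popSet_mono Z (Set.union_subset h.subset ?_)).trans (popSet_target_subset Z L)
    exact fun y hy => hy.2.mem h.mem hL.saturated
  · rintro σ fin fin' hσ ha hf hact x ⟨x', r, hx, hx' | hx'⟩
    · exact Anchored.push ha ⟨x', r, hx, hx'⟩ hm hf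
    · obtain ⟨h1, u, hu⟩ := hact hx'.1
      exact anchored_of_climb hu hσ ⟨x', r, hx, hx'.2⟩ hm fun h2 => (hf h2).resolve_left h1

theorem RestInv.of_suffix {p : Q} {L K : List (Entry Q)} (h : A.RestInv p L) (hK : K <:+ L) :
    A.RestInv p K := by
  induction L with
  | nil => rwa [List.suffix_nil.1 hK]
  | cons e L ih =>
    rcases List.suffix_cons_iff.1 hK with rfl | hK
    · exact h
    · exact ih h.2 hK

theorem RestInv.target_subset {p : Q} {L₁ L₂ : List (Entry Q)} {e : Entry Q}
    (h : A.RestInv p (L₁ ++ e :: L₂)) : target (L₁ ++ e :: L₂) ⊆ e.2.2 := by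
  induction L₁ with
  | nil => exact subset_rfl
  | cons f L ih => exact h.1.subset.trans (ih h.2)

theorem kept_suffix (L : List (Entry Q)) (y : Q) : kept L y <:+ L := List.dropWhile_suffix _

theorem mem_target_kept (L : List (Entry Q)) (y : Q) : y ∈ target (kept L y) := by
  classical
  induction L with
  | nil => trivial
  | cons e L ih =>
    by_cases h : y ∈ e.2.2
    · rw [show kept (e :: L) y = e :: L by simp [kept, h]]
      exact h
    · rwa [show kept (e :: L) y = kept L y by simp [kept, h]]

/-- No situation is recorded twice. -/
theorem RestInv.notMem_reps [Finite Q] {p : Q} {L : List (Entry Q)} (hA : ¬ A.HasForbiddenPattern)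
    (h : A.RestInv p L) (hp : p ∉ A.final) (hpL : p ∈ target L) :
    (p, target L) ∉ reps L := by
  intro hmem
  obtain ⟨e, he, heq⟩ := List.mem_map.1 hmem
  simp only [Prod.mk.injEq] at heq
  obtain ⟨L₁, L₂, rfl⟩ := List.append_of_mem he
  have hsub := h.target_subset
  have h2 := (h.of_suffix (List.suffix_append L₁ _)).1
  obtain ⟨σ, hσ, ⟨-, -, hc⟩ | ⟨-, ha⟩⟩ := h2.cert
  -- No final step since the record: the empty climb shows that the record is still equivalent to
  -- the present situation, but it is inactive.
  · refine hc.2 ?_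
    rw [heq.1, heq.2]
    exact climb_self hp (hsub.trans h2.subset)
  · rw [heq.1, heq.2] at ha
    -- The sets `Y` are nested, so the whole target lies in the `Y` of the old record and is
    -- anchored through a final step.
    exact hA (hasForbiddenPattern_of_anchored hpL fun x hx => ha x (hsub hx))

theorem restInv_of_not_active {p y : Q} {L : List (Entry Q)} (hrest : A.RestInv y L.tail)
    (htop : ∀ e ∈ L.head?, A.EntryInv y (target L.tail) e
      (p ∉ A.final ∧ A.Climb y (target L.tail) e.1 e.2.1)) (hact : ¬ A.Active p L y) :
    A.RestInv y L := by
  cases L with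
  | nil => trivial
  | cons e L =>
    exact ⟨(htop e rfl).congr (iff_false_intro fun h => hact ⟨h.1, e, L, rfl, h.2⟩), hrest⟩

theorem listInv_updList {p y : Q} {L : List (Entry Q)} (hrest : A.RestInv y L.tail)
    (htop : ∀ e ∈ L.head?, A.EntryInv y (target L.tail) e
      (p ∉ A.final ∧ A.Climb y (target L.tail) e.1 e.2.1)) : A.ListInv y (A.updList p L y) := by
  unfold updList
  split_ifs with hact hy
  · obtain ⟨hp, e, L, rfl, hcl⟩ := hact
    exact ⟨(htop e rfl).congr (by simp [hp, hcl, hcl.not_final]), hrest⟩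
  · have hL := restInv_of_not_active hrest htop hact
    have hK := hL.of_suffix (kept_suffix L y)
    generalize kept L y = K at hK
    cases K with
    | nil => exact hy
    | cons e K => exact ⟨hK.1.congr (by simp [hy]), hK.2⟩
  · have hL := restInv_of_not_active hrest htop hact
    refine ⟨⟨mem_target_kept L y, Set.empty_subset _, fun _ _ _ h => h, [], mapsTo_nil subset_rfl,
      .inl ⟨⟨[], .refl hy⟩, fun x hx => hx.elim, fun _ => climb_self hy subset_rfl,
        fun _ => hy⟩⟩, ?_⟩
    exact hL.of_suffix (kept_suffix L y)

theorem nodup_reps_updList [Finite Q] (hA : ¬ A.HasForbiddenPattern) {p y : Q}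
    {L : List (Entry Q)} (hrest : A.RestInv y L.tail)
    (htop : ∀ e ∈ L.head?, A.EntryInv y (target L.tail) e
      (p ∉ A.final ∧ A.Climb y (target L.tail) e.1 e.2.1)) (hL : (reps L).Nodup) :
    (reps (A.updList p L y)).Nodup := by
  unfold updList
  have hK : (reps (kept L y)).Nodup := hL.sublist ((kept_suffix L y).sublist.map _)
  split_ifs with hact hy
  · exact hL
  · exact hK
  · have hL := restInv_of_not_active hrest htop hact
    exact List.nodup_cons.2
      ⟨(hL.of_suffix (kept_suffix L y)).notMem_reps hA hy (mem_target_kept L y), hK⟩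

theorem reps_pushList (p : Q) (Z : Γ) (L : List (Entry Q)) : reps (A.pushList p Z L) = reps L := by
  cases L with
  | nil => rfl
  | cons e L => simp [reps, pushList, pushEntry]

/-- The invariant is preserved on a level. -/
theorem ListInv.move [Finite Q] (hA : ¬ A.HasForbiddenPattern) {p y : Q} {L : List (Entry Q)}
    {w : List (VPLetter C I R)} (h : A.ListInv p L) (hL : (reps L).Nodup) (hm : A.Move p y w []) :
    A.ListInv y (A.updList p L y) ∧ (reps (A.updList p L y)).Nodup := by
  have h1 : A.RestInv y L.tail := by
    cases L with
    | nil => trivial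
    | cons e L => exact h.2.move hm
  have h2 : ∀ e ∈ L.head?, A.EntryInv y (target L.tail) e
      (p ∉ A.final ∧ A.Climb y (target L.tail) e.1 e.2.1) := by
    cases L with
    | nil => simp
    | cons e L => rintro _ ⟨⟩; exact h.1.move hm
  exact ⟨listInv_updList h1 h2, nodup_reps_updList hA h1 h2 hL⟩

/-- The invariant is preserved by calls. -/
theorem ListInv.push [Finite Q] [Nonempty R] (hA : ¬ A.HasForbiddenPattern) {p y : Q}
    {L : List (Entry Q)} {c : C} {Z : Γ} (h : A.ListInv p L) (hL : (reps L).Nodup)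
    (hm : A.Move p y [call c] [Z]) :
    A.ListInv y (A.updList p (A.pushList p Z L) y) ∧
      (reps (A.updList p (A.pushList p Z L) y)).Nodup := by
  have h1 : A.RestInv y (A.pushList p Z L).tail := by
    cases L with
    | nil => trivial
    | cons e L => exact h.2.push hm
  have h2 : ∀ e ∈ (A.pushList p Z L).head?, A.EntryInv y (target (A.pushList p Z L).tail) e
      (p ∉ A.final ∧ A.Climb y (target (A.pushList p Z L).tail) e.1 e.2.1) := by
    cases L with
    | nil => simp [pushList]
    | cons e L => rintro _ ⟨⟩; exact h.1.push h.2 hm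
  exact ⟨listInv_updList h1 h2, nodup_reps_updList hA h1 h2 (by rwa [reps_pushList])⟩

end StairBuchiDVPA

/-! ### The tracker and the survival of records inside matched factors. -/

namespace StairBuchiDVPA

open VPLetter DVPMachine

variable {C I R Q Γ : Type*} (A : StairBuchiDVPA C I R Q Γ)

/-- A state together with the records and the number of records that survived the last move. -/
abbrev TrackState (Q : Type*) := Q × List (Entry Q) × ℕ

noncomputable def upd (p : Q) (L : List (Entry Q)) (y : Q) : TrackState Q :=
  (y, A.updList p L y, A.updCount p L y)

noncomputable def trackCall (s : TrackState Q) (c : C) : TrackState Q :=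
  A.upd s.1 (A.pushList s.1 (A.callStep s.1 c).2 s.2.1) (A.callStep s.1 c).1

/-- The machine that keeps track of the records. The state before a call is put on the stack. -/
noncomputable def tracker : DVPMachine C I R (TrackState Q) (TrackState Q × Γ) where
  init := A.upd A.init [] A.init
  callStep s c := (A.trackCall s c, (s, (A.callStep s.1 c).2))
  retStep s Z r := A.upd Z.1.1 Z.1.2.1 (A.retStep s.1 Z.2 r)
  intStep s a := A.upd s.1 s.2.1 (A.intStep s.1 a)

/-- The lowest `k` records. -/
def low (k : ℕ) (L : List (Entry Q)) : List (Entry Q) := L.drop (L.length - k)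

variable {A}

theorem low_of_suffix {k : ℕ} {K L : List (Entry Q)} (h : K <:+ L) (hk : k ≤ K.length) :
    low k L = low k K := by
  obtain ⟨M, rfl⟩ := h
  unfold low
  rw [List.length_append, show M.length + K.length - k = M.length + (K.length - k) by omega,
    ← List.drop_drop]
  simp

theorem low_length (L : List (Entry Q)) : low L.length L = L := by simp [low]

theorem low_cons {k : ℕ} {e : Entry Q} {L : List (Entry Q)} (hk : k ≤ L.length) :
    low k (e :: L) = low k L := low_of_suffix (List.suffix_cons e L) hk

theorem updCount_le (p : Q) (L : List (Entry Q)) (y : Q) :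
    A.updCount p L y ≤ (A.updList p L y).length := by
  unfold updCount updList
  split_ifs <;> simp

theorem updCount_le_length (p : Q) (L : List (Entry Q)) (y : Q) :
    A.updCount p L y ≤ L.length := by
  unfold updCount
  split_ifs
  · rfl
  · exact (kept_suffix L y).length_le

theorem low_updList {k : ℕ} {p : Q} {L : List (Entry Q)} {y : Q} (hk : k ≤ A.updCount p L y) :
    low k (A.updList p L y) = low k L := by
  unfold updCount at hk
  unfold updList
  split_ifs at hk ⊢
  · rfl
  · exact (low_of_suffix (kept_suffix L y) hk).symm
  · rw [low_cons hk]
    exact (low_of_suffix (kept_suffix L y) hk).symm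

/-- Dropping stops at the latest at the `k`-th record from below, as `y` lies in its third
component. -/
theorem le_length_kept {k : ℕ} {L : List (Entry Q)} {y : Q} (hk : k ≤ L.length)
    (hy : y ∈ target (low k L)) : k ≤ (kept L y).length := by
  classical
  induction L with
  | nil => exact hk
  | cons e L ih =>
    by_cases h : y ∈ e.2.2
    · rwa [show kept (e :: L) y = e :: L by simp [kept, h]]
    · rw [show kept (e :: L) y = kept L y by simp [kept, h]]
      rcases Nat.lt_or_ge L.length k with h1 | h1
      · obtain rfl : k = (e :: L).length := by simp at *; omega
        rw [low_length] at hy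
        exact absurd hy h
      · exact ih h1 (by rwa [low_cons h1] at hy)

theorem le_updCount {k : ℕ} {p : Q} {L : List (Entry Q)} {y : Q} (hk : k ≤ L.length)
    (hy : y ∈ target (low k L)) : k ≤ A.updCount p L y := by
  unfold updCount
  split_ifs
  · exact hk
  · exact le_length_kept hk hy

@[simp] theorem length_pushList (p : Q) (Z : Γ) (L : List (Entry Q)) :
    (A.pushList p Z L).length = L.length := by
  cases L <;> simp [pushList]

theorem low_map {k : ℕ} (f : Entry Q → Entry Q) (L : List (Entry Q)) :
    low k (L.map f) = (low k L).map f := by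
  simp [low, List.map_drop]

theorem low_pushList {k : ℕ} {p : Q} {Z : Γ} {L : List (Entry Q)} (hk : k < L.length) :
    low k (A.pushList p Z L) = (low k L).map (A.pushEntry Z) := by
  cases L with
  | nil => simp at hk
  | cons e L =>
    simp only [List.length_cons] at hk
    rw [pushList, low_cons (by simp; omega), low_cons (by omega), low_map]

theorem popSet_low_subset {k : ℕ} {p : Q} {Z : Γ} {L : List (Entry Q)} (hk : k ≤ L.length) :
    A.popSet Z (target (low k L)) ⊆ target (low k (A.pushList p Z L)) := by
  rcases hk.eq_or_lt with rfl | hk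
  · have h1 := low_length (A.pushList p Z L)
    rw [length_pushList] at h1
    rw [low_length, h1]
    cases L with
    | nil => exact Set.subset_univ _
    | cons e L => exact popSet_mono Z Set.subset_union_left
  · rw [low_pushList hk]
    exact popSet_target_subset Z _

/-- If the matched factor ends in an active move, this rests on the climbing states that `pushList`
puts into the top record. Otherwise `y` already lies in the target of the surviving records. -/
theorem popSet_singleton_subset {p y : Q} {Z : Γ} {L : List (Entry Q)} :
    A.popSet Z {y} ⊆ target (low (A.updCount p L y) (A.pushList p Z L)) := by
  by_cases h : A.Active p L y
  · have h1 := low_length (A.pushList p Z L)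
    rw [length_pushList] at h1
    rw [updCount, if_pos h, h1]
    obtain ⟨hp, e, L, rfl, hc⟩ := h
    refine popSet_mono Z ?_
    rintro _ rfl
    exact .inr ⟨hp, hc⟩
  · rw [updCount, if_neg h]
    refine subset_trans (popSet_mono Z ?_) (popSet_low_subset (kept_suffix L y).length_le)
    rw [low_of_suffix (kept_suffix L y) le_rfl, low_length]
    rintro _ rfl
    exact mem_target_kept L _

/-- An inactive move to a nonfinal state adds a record, which makes the list longer than the number
of survivors. -/
theorem active_of_length {p y : Q} {L : List (Entry Q)} (hy : y ∉ A.final)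
    (h : (A.updList p L y).length = A.updCount p L y) : A.Active p L y := by
  by_contra hc
  simp [updList, updCount, hc, hy] at h

/-- The sequence of heights of a run changes by at most one. -/
theorem _root_.DVPMachine.IsRun.le_height_succ {Q Γ : Type*} {M : DVPMachine C I R Q Γ}
    {α : ℕ → VPLetter C I R} {ρ : ℕ → VPConf Q Γ} (h : M.IsRun α ρ) (n : ℕ) :
    (ρ n).2.length ≤ (ρ (n + 1)).2.length + 1 := by
  have h1 := step_height (h.2 n)
  have h2 := le_weight (α n)
  omega

variable {α : ℕ → VPLetter C I R} {ρ : ℕ → VPConf (TrackState Q) (TrackState Q × Γ)}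

theorem isRun_of_tracker (h : A.tracker.IsRun α ρ) :
    A.IsRun α (fun n => ((ρ n).1.1, (ρ n).2.map Prod.snd)) :=
  h.map Prod.fst Prod.snd rfl (fun _ _ => rfl) (fun _ _ _ => rfl) (fun _ _ => rfl)

/-- `x` is the last position before `t` on the level of `t`. -/
structure PredLevel (A : StairBuchiDVPA C I R Q Γ)
    (ρ : ℕ → VPConf (TrackState Q) (TrackState Q × Γ)) (x t : ℕ) : Prop where
  lt : x < t
  height_eq : (ρ x).2.length = (ρ t).2.length
  height_lt : ∀ j, x < j → j < t → (ρ t).2.length < (ρ j).2.length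
  eq : (ρ t).1 = A.upd (ρ x).1.1 (ρ x).1.2.1 (ρ t).1.1

/-- A call leads from position `x` to position `t`. -/
structure PredCall (A : StairBuchiDVPA C I R Q Γ) (α : ℕ → VPLetter C I R)
    (ρ : ℕ → VPConf (TrackState Q) (TrackState Q × Γ)) (x t : ℕ) (c : C) : Prop where
  eq_succ : t = x + 1
  letter : α x = call c
  eq : (ρ t).1 = A.trackCall (ρ x).1 c
  stack : (ρ t).2 = ((ρ x).1, (A.callStep (ρ x).1.1 c).2) :: (ρ x).2

theorem exists_push (h : A.tracker.IsRun α ρ) (t : ℕ) {s : TrackState Q} {Z : Γ}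
    {l : List (TrackState Q × Γ)} (hst : (ρ t).2 = (s, Z) :: l) :
    ∃ x < t, ∃ c, α x = call c ∧ ρ x = (s, l) ∧ Z = (A.callStep s.1 c).2 ∧
      ∀ j, x < j → j ≤ t → l.length < (ρ j).2.length := by
  induction t using Nat.strong_induction_on generalizing s Z l with
  | _ t ih =>
    cases t with
    | zero => simp [h.1] at hst
    | succ t =>
      have h1 := h.2 t
      have h2 : ρ t = ((ρ t).1, (ρ t).2) := rfl
      generalize ha : α t = a at h1
      cases a with
      | call c =>
        rw [h2, step, Option.some.injEq] at h1
        rw [← h1] at hst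
        simp only [tracker, List.cons.injEq, Prod.mk.injEq] at hst
        obtain ⟨⟨rfl, rfl⟩, rfl⟩ := hst
        refine ⟨t, by omega, c, ha, rfl, rfl, fun j h3 h4 => ?_⟩
        obtain rfl : j = t + 1 := by omega
        rw [← h1]
        simp
      | internal a =>
        rw [h2, step, Option.some.injEq] at h1
        have h3 : (ρ (t + 1)).2 = (ρ t).2 := by rw [← h1]
        obtain ⟨x, hx, c, hc, hx', hZ, hh⟩ := ih t (by omega) (h3 ▸ hst)
        refine ⟨x, by omega, c, hc, hx', hZ, fun j h4 h5 => ?_⟩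
        rcases h5.eq_or_lt with rfl | h5
        · rw [hst]; simp
        · exact hh j h4 (by omega)
      | ret r =>
        cases hl : (ρ t).2 with
        | nil =>
          rw [h2, hl, step] at h1
          simp at h1
        | cons e l' =>
          rw [h2, hl, step, Option.some.injEq] at h1
          have h3 : (ρ (t + 1)).2 = l' := by rw [← h1]
          -- The symbol popped now is traced to its call at `x₁`; the stack there is the present
          -- one, so the search continues from `x₁`.
          obtain ⟨x₁, hx₁, c₁, -, hx₁', -, hh₁⟩ := ih t (by omega) (s := e.1) (Z := e.2) hl
          obtain ⟨x, hx, c, hc, hx', hZ, hh⟩ := ih x₁ (by omega) (s := s) (Z := Z) (l := l)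
            (by rw [hx₁', ← h3, hst])
          refine ⟨x, by omega, c, hc, hx', hZ, fun j h4 h5 => ?_⟩
          rcases h5.eq_or_lt with rfl | h5
          · rw [hst]; simp
          · rcases Nat.lt_or_ge x₁ j with h6 | h6
            · have := hh₁ j h6 (by omega)
              rw [← h3, hst, List.length_cons] at this
              omega
            · exact hh j h4 h6

theorem exists_pred (h : A.tracker.IsRun α ρ) {t : ℕ} (ht : 0 < t) :
    ∃ x, PredLevel A ρ x t ∨ ∃ c, PredCall A α ρ x t c := by
  obtain ⟨t, rfl⟩ := Nat.exists_eq_add_of_lt ht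
  rw [zero_add]
  have h1 := h.2 t
  have h2 : ρ t = ((ρ t).1, (ρ t).2) := rfl
  generalize ha : α t = a at h1
  cases a with
  | call c =>
    rw [h2, step, Option.some.injEq] at h1
    exact ⟨t, .inr ⟨c, rfl, ha, by rw [← h1]; rfl, by rw [← h1]; rfl⟩⟩
  | internal a =>
    rw [h2, step, Option.some.injEq] at h1
    exact ⟨t, .inl ⟨by omega, by rw [← h1], fun j _ _ => by omega, by rw [← h1]; rfl⟩⟩
  | ret r =>
    cases hl : (ρ t).2 with
    | nil =>
      rw [h2, hl, step] at h1
      simp at h1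
    | cons e l =>
      rw [h2, hl, step, Option.some.injEq] at h1
      obtain ⟨x, hx, c, -, hx', -, hh⟩ := exists_push h t (s := e.1) (Z := e.2) hl
      refine ⟨x, .inl ⟨by omega, by rw [hx', ← h1], fun j h4 h5 => ?_, ?_⟩⟩
      · rw [← h1]
        exact hh j h4 (by omega)
      · rw [hx', ← h1]
        rfl

theorem PredLevel.exists_move (h : A.tracker.IsRun α ρ) {x t : ℕ} (hp : PredLevel A ρ x t) :
    ∃ w, A.Move (ρ x).1.1 (ρ t).1.1 w [] := by
  have hA := isRun_of_tracker h
  obtain ⟨σ, hσ, ρ', hρ', hpos⟩ := hA.isFinRun_of_le hp.lt.le (s := []) rfl fun i h1 h2 => by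
    simp only [List.length_map]
    rcases h1.eq_or_lt with rfl | h1
    · rfl
    rcases h2.eq_or_lt with rfl | h2
    · exact hp.height_eq.le
    exact hp.height_eq ▸ (hp.height_lt i h1 h2).le
  obtain rfl : σ = [] := by
    have h3 := congrArg List.length hσ
    have h4 := hp.height_eq
    simp only [List.length_map, List.length_append] at h3
    exact List.eq_nil_of_length_eq_zero (by omega)
  refine ⟨_, ⟨ρ', hρ'⟩, fun hx ht => ⟨ρ', hρ', fun i _ => by simp, fun n hn => ?_⟩⟩
  have hn1 := hn.1
  rw [length_segment] at hn1
  rcases Nat.eq_zero_or_pos n with rfl | h0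
  · rwa [hρ'.1]
  rcases hn.1.eq_or_lt with h1 | h1
  · rw [h1, hρ'.2.1]
    exact ht
  exfalso
  have h2 := hn.2 _ hn.1 le_rfl
  rw [hρ'.2.1] at h2
  have h3 := congrArg List.length (hpos n hn1).2
  rw [length_segment] at h1
  have h4 := hp.height_lt (x + n) (by omega) (by omega)
  have h5 := hp.height_eq
  simp at h2 h3
  simp [h2] at h3
  omega

theorem PredCall.move {x t : ℕ} {c : C} (hp : PredCall A α ρ x t c) :
    A.Move (ρ x).1.1 (ρ t).1.1 [call c] [(A.callStep (ρ x).1.1 c).2] := by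
  have h : A.Reach [call c] ((ρ x).1.1, []) ((ρ t).1.1, [(A.callStep (ρ x).1.1 c).2]) := by
    rw [hp.eq]
    exact Reach.single rfl
  refine ⟨h, fun h1 h2 => reachNonfinal_of_interior h h1 h2 fun v w e hv hw => ?_⟩
  have := congrArg List.length e
  have h3 := List.length_pos_iff.2 hv
  have h4 := List.length_pos_iff.2 hw
  simp at this
  omega

theorem PredCall.eq_upd {x t : ℕ} {c : C} (hp : PredCall A α ρ x t c) :
    (ρ t).1 = A.upd (ρ x).1.1 (A.pushList (ρ x).1.1 (A.callStep (ρ x).1.1 c).2 (ρ x).1.2.1)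
      (ρ t).1.1 := by
  rw [hp.eq]
  rfl

/-- The induction follows predecessors on a level or across a call, because a return resumes from
the tracker state stored at its call. -/
theorem listInv_of_isRun [Finite Q] [Nonempty R] (hA : ¬ A.HasForbiddenPattern)
    (h : A.tracker.IsRun α ρ) (t : ℕ) :
    A.ListInv (ρ t).1.1 (ρ t).1.2.1 ∧ (reps (ρ t).1.2.1).Nodup := by
  induction t using Nat.strong_induction_on with
  | _ t ih =>
    rcases Nat.eq_zero_or_pos t with rfl | ht
    · rw [h.1]
      exact ⟨listInv_updList trivial (by simp),
        nodup_reps_updList hA trivial (by simp) List.nodup_nil⟩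
    · obtain ⟨x, hx | ⟨c, hx⟩⟩ := exists_pred h ht
      · obtain ⟨w, hw⟩ := hx.exists_move h
        obtain ⟨h1, h2⟩ := ih x hx.lt
        rw [hx.eq]
        exact h1.move hA h2 hw
      · obtain ⟨h1, h2⟩ := ih x (by have := hx.eq_succ; omega)
        rw [hx.eq_upd]
        exact h1.push hA h2 hx.move

theorem count_le_length (h : A.tracker.IsRun α ρ) (t : ℕ) :
    (ρ t).1.2.2 ≤ (ρ t).1.2.1.length := by
  rcases Nat.eq_zero_or_pos t with rfl | ht
  · rw [h.1]
    exact updCount_le _ _ _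
  · obtain ⟨x, hx | ⟨c, hx⟩⟩ := exists_pred h ht
    · rw [hx.eq]
      exact updCount_le _ _ _
    · rw [hx.eq_upd]
      exact updCount_le _ _ _

theorem mem_popSet_of_height (h : A.tracker.IsRun α ρ) {y i j : ℕ} {c : C}
    (hc : PredCall A α ρ y (y + 1) c) (hyi : y < i) (hij : i < j)
    (hi : (ρ i).2.length = (ρ y).2.length + 1) (hj : (ρ j).2.length = (ρ y).2.length)
    (hlt : ∀ l, y < l → l < j → (ρ y).2.length < (ρ l).2.length) :
    (ρ i).1.1 ∈ A.popSet (A.callStep (ρ y).1.1 c).2 {(ρ j).1.1} := by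
  have hA := isRun_of_tracker h
  have hlen := congrArg List.length hc.stack
  simp only [List.length_cons] at hlen
  obtain ⟨j, rfl⟩ : ∃ j', j = j' + 1 := ⟨j - 1, by omega⟩
  have hle : ∀ m n, y < m → n < j + 1 → ∀ l, m ≤ l → l ≤ n →
      (ρ (y + 1)).2.length ≤ (ρ l).2.length := by
    intro m n hm hn l h1 h2
    have := hlt l (by omega) (by omega)
    omega
  obtain ⟨σ, hσ, -⟩ := hA.isFinRun_of_le (m := y + 1) (n := i) (by omega) (s := []) rfl
    fun l h1 h2 => by simpa using hle _ _ (Nat.lt_succ_self y) (by omega) l h1 h2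
  obtain rfl : σ = [] := by
    have h3 := congrArg List.length hσ
    simp only [List.length_map, List.length_append] at h3
    exact List.eq_nil_of_length_eq_zero (by omega)
  obtain ⟨σ', hσ', ρ', hρ', -⟩ := hA.isFinRun_of_le (m := i) (n := j) (by omega) (s := []) hσ
    fun l h1 h2 => by simpa using hle i j hyi (by omega) l h1 h2
  have h4 := hA.2 j
  have h5 := step_height h4
  have h6 := hlt j (by omega) (by omega)
  simp only [List.length_map] at h5
  generalize α j = a at h4 h5
  cases a with
  | call c => simp only [weight] at h5; omega
  | internal a => simp only [weight] at h5; omega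
  | ret r =>
    obtain rfl : σ' = [] := by
      have h3 := congrArg List.length hσ'
      simp only [List.length_map, List.length_append] at h3
      simp only [weight] at h5
      exact List.eq_nil_of_length_eq_zero (by omega)
    refine ⟨_, r, ⟨_, ρ', hρ'⟩, ?_⟩
    have h7 : (ρ j).2.map Prod.snd =
        (A.callStep (ρ y).1.1 c).2 :: (ρ y).2.map Prod.snd := by
      simpa [hc.stack] using hσ'
    dsimp only at h4
    rw [h7, step, Option.some.injEq, Prod.mk.injEq] at h4
    exact h4.1

/-- Records that survive a well-matched word survive all moves inside. -/
theorem PredLevel.count_le (h : A.tracker.IsRun α ρ) {x t : ℕ} (hp : PredLevel A ρ x t) {j : ℕ}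
    (hxj : x < j) (hjt : j < t) : (ρ t).1.2.2 ≤ (ρ j).1.2.2 := by
  have hd : (ρ t).1.2.2 = A.updCount (ρ x).1.1 (ρ x).1.2.1 (ρ t).1.1 := by
    conv_lhs => rw [hp.eq]
    rfl
  generalize he : (ρ t).1.2.2 = e at hd
  -- The last clause makes the induction work: the states still to come on the level of `j` lie in
  -- the target of the lowest `e` records, so no move there drops one of these.
  suffices key : ∀ j, x < j → j < t → e ≤ (ρ j).1.2.2 ∧ e ≤ (ρ j).1.2.1.length ∧
      ∀ i, j ≤ i → i < t → (ρ i).2.length = (ρ j).2.length →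
        (∀ l, j ≤ l → l ≤ i → (ρ j).2.length ≤ (ρ l).2.length) →
        (ρ i).1.1 ∈ target (low e (ρ j).1.2.1) from (key j hxj hjt).1
  clear hxj hjt j
  intro j
  induction j using Nat.strong_induction_on with
  | _ j ih =>
    intro hxj hjt
    obtain ⟨y, hy | ⟨c, hy⟩⟩ := exists_pred h (show 0 < j by omega)
    · have hxy : x < y := by
        have h1 := hp.height_lt j hxj hjt
        have h2 := hp.height_eq
        have h3 := hy.height_eq
        rcases lt_trichotomy x y with h4 | h4 | h4
        · exact h4
        · subst h4; omega
        · have := hy.height_lt x h4 hxj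
          omega
      have hyj := hy.lt
      obtain ⟨h1, h2, h3⟩ := ih y hyj hxy (by omega)
      have hyl : ∀ l, y ≤ l → l ≤ j → (ρ y).2.length ≤ (ρ l).2.length := by
        intro l h4 h5
        rw [hy.height_eq]
        rcases h5.eq_or_lt with rfl | h5
        · rfl
        rcases h4.eq_or_lt with rfl | h4
        · exact hy.height_eq.ge
        exact (hy.height_lt l h4 h5).le
      have h4 := h3 j hyj.le hjt hy.height_eq.symm hyl
      have h5 : e ≤ A.updCount (ρ y).1.1 (ρ y).1.2.1 (ρ j).1.1 := le_updCount h2 h4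
      have h6 : (ρ j).1.2.2 = A.updCount (ρ y).1.1 (ρ y).1.2.1 (ρ j).1.1 := by
        conv_lhs => rw [hy.eq]
        rfl
      have h7 : (ρ j).1.2.1 = A.updList (ρ y).1.1 (ρ y).1.2.1 (ρ j).1.1 := by
        conv_lhs => rw [hy.eq]
        rfl
      refine ⟨h6 ▸ h5, h7 ▸ h5.trans (updCount_le _ _ _), fun i h8 h9 h10 h11 => ?_⟩
      rw [h7, low_updList h5]
      refine h3 i (by omega) h9 (by rw [h10, hy.height_eq]) fun l h12 h13 => ?_
      rcases le_total l j with h14 | h14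
      · exact hyl l h12 h14
      · rw [hy.height_eq]
        exact h11 l h14 h13
    · have hyj := hy.eq_succ
      subst hyj
      have hlen : (ρ (y + 1)).2.length = (ρ y).2.length + 1 := by rw [hy.stack]; simp
      have h6 : (ρ (y + 1)).1.2.2 = A.updCount (ρ y).1.1 _ (ρ (y + 1)).1.1 :=
        congrArg (fun s => s.2.2) hy.eq_upd
      have h7 : (ρ (y + 1)).1.2.1 = A.updList (ρ y).1.1 _ (ρ (y + 1)).1.1 :=
        congrArg (fun s => s.2.1) hy.eq_upd
      generalize hZ : (A.callStep (ρ y).1.1 c).2 = Z at h6 h7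
      have hel : e ≤ (ρ y).1.2.1.length := by
        rcases (Nat.lt_succ_iff.1 hxj).eq_or_lt with rfl | hxy
        · rw [hd]
          exact updCount_le_length _ _ _
        · exact (ih y (by omega) hxy (by omega)).2.1
      have hmem : ∀ i, y + 1 ≤ i → i < t → (ρ i).2.length = (ρ (y + 1)).2.length →
          (∀ l, y + 1 ≤ l → l ≤ i → (ρ (y + 1)).2.length ≤ (ρ l).2.length) →
          (ρ i).1.1 ∈ target (low e (A.pushList (ρ y).1.1 Z (ρ y).1.2.1)) := by
        intro i h8 h9 h10 h11
        have hxy : (ρ x).2.length ≤ (ρ y).2.length := by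
          rcases (Nat.lt_succ_iff.1 hxj).eq_or_lt with rfl | hxy
          · rfl
          · rw [hp.height_eq]
            exact (hp.height_lt y hxy (by omega)).le
        -- The first such `n` is where the return matching the call at `y` arrives.
        have hex : ∃ n, i < n ∧ (ρ n).2.length ≤ (ρ y).2.length :=
          ⟨t, h9, by rw [← hp.height_eq]; exact hxy⟩
        classical
        obtain ⟨hin, hn⟩ := Nat.find_spec hex
        have hmin := fun m => Nat.find_min (H := hex) (m := m)
        have hnt : Nat.find hex ≤ t := Nat.find_min' hex ⟨h9, by rw [← hp.height_eq]; exact hxy⟩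
        generalize Nat.find hex = n at hin hn hmin hnt
        have hlt : ∀ l, y < l → l < n → (ρ y).2.length < (ρ l).2.length := by
          intro l h12 h13
          rcases le_or_gt l i with h14 | h14
          · have := h11 l h12 h14
            omega
          · by_contra h15
            exact hmin l h13 ⟨h14, by omega⟩
        have hneq : (ρ n).2.length = (ρ y).2.length := by
          have h12 := hlt (n - 1) (by omega) (by omega)
          have h13 := h.le_height_succ (n - 1)
          rw [show n - 1 + 1 = n by omega] at h13
          omega
        have hpop := mem_popSet_of_height h hy h8 hin (by omega) hneq hlt
        rw [hZ] at hpop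
        -- A call at `x` itself is matched at `t`, where `e` records survive by the choice of `e`.
        -- Any other call is matched strictly before `t`, and the induction hypothesis at `y`
        -- applies.
        rcases (Nat.lt_succ_iff.1 hxj).eq_or_lt with rfl | hxy'
        · obtain rfl : n = t := by
            rcases hnt.eq_or_lt with h12 | h12
            · exact h12
            · have := hp.height_lt n (by omega) h12
              have := hp.height_eq
              omega
          rw [hd]
          exact popSet_singleton_subset hpop
        · have hn' : n < t := by
            rcases hnt.eq_or_lt with rfl | h12
            · have := hp.height_lt y hxy' (by omega)
              omega
            · exact h12
          have h13 := (ih y (by omega) hxy' (by omega)).2.2 n (by omega) hn' hneq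
              fun l h14 h15 => by
            rcases h14.eq_or_lt with rfl | h14
            · rfl
            rcases h15.eq_or_lt with rfl | h15
            · exact hneq.ge
            exact (hlt l h14 h15).le
          refine popSet_low_subset hel (popSet_mono Z ?_ hpop)
          rintro _ rfl
          exact h13
      have h5 : e ≤ A.updCount (ρ y).1.1 (A.pushList (ρ y).1.1 Z (ρ y).1.2.1) (ρ (y + 1)).1.1 := by
        refine le_updCount (by rwa [length_pushList]) (hmem _ le_rfl hjt rfl fun l h8 h9 => ?_)
        rw [le_antisymm h8 h9]
      refine ⟨h6 ▸ h5, h7 ▸ h5.trans (updCount_le _ _ _), fun i h8 h9 h10 h11 => ?_⟩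
      rw [h7, low_updList h5]
      exact hmem i h8 h9 h10 h11

end StairBuchiDVPA

/-! ### Acceptance read off from the number of surviving records. -/

theorem exists_isStairStep {Q Γ : Type*} (ρ : ℕ → VPConf Q Γ) (n : ℕ) :
    ∃ s, n ≤ s ∧ IsStairStep ρ s := by
  have hex : ∃ v, ∃ m, n ≤ m ∧ (ρ m).2.length = v := ⟨_, n, le_rfl, rfl⟩
  classical
  obtain ⟨s, hs, hv⟩ := Nat.find_spec hex
  exact ⟨s, hs, fun m hm => hv ▸ Nat.find_min' hex ⟨m, hs.trans hm, rfl⟩⟩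

namespace StairBuchiDVPA

open VPLetter DVPMachine

variable {C I R Q Γ : Type*} {A : StairBuchiDVPA C I R Q Γ}
  {α : ℕ → VPLetter C I R} {ρ : ℕ → VPConf (TrackState Q) (TrackState Q × Γ)}

/-- The states of the tracker that get an odd priority: all records have survived the last move,
and the state is not final. -/
def IsOdd (A : StairBuchiDVPA C I R Q Γ) (s : TrackState Q) : Prop :=
  s.1 ∉ A.final ∧ s.2.1.length = s.2.2

theorem PredLevel.isStairStep {x t : ℕ} (hp : PredLevel A ρ x t) (ht : IsStairStep ρ t) :
    IsStairStep ρ x := by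
  intro m hm
  rw [hp.height_eq]
  rcases lt_or_ge m t with h1 | h1
  · rcases hm.eq_or_lt with rfl | hm
    · exact hp.height_eq.ge
    · exact (hp.height_lt m hm h1).le
  · exact ht m h1

theorem PredCall.isStairStep {x t : ℕ} {c : C} (hp : PredCall A α ρ x t c)
    (ht : IsStairStep ρ t) : IsStairStep ρ x := by
  intro m hm
  rcases hm.eq_or_lt with rfl | hm
  · rfl
  · have h1 := ht m (by have := hp.eq_succ; omega)
    rw [hp.stack, List.length_cons] at h1
    omega

theorem PredLevel.le_of_isStairStep {s x t : ℕ} (hp : PredLevel A ρ x t) (hs : IsStairStep ρ s)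
    (hst : s < t) : s ≤ x := by
  by_contra h
  have h1 := hp.height_lt s (by omega) hst
  have h2 := hs t hst.le
  omega

theorem PredLevel.list_eq {x t : ℕ} (hp : PredLevel A ρ x t) :
    (ρ t).1.2.1 = A.updList (ρ x).1.1 (ρ x).1.2.1 (ρ t).1.1 := congrArg (fun s => s.2.1) hp.eq

theorem PredLevel.count_eq {x t : ℕ} (hp : PredLevel A ρ x t) :
    (ρ t).1.2.2 = A.updCount (ρ x).1.1 (ρ x).1.2.1 (ρ t).1.1 := congrArg (fun s => s.2.2) hp.eq

theorem PredCall.list_eq {x t : ℕ} {c : C} (hp : PredCall A α ρ x t c) :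
    (ρ t).1.2.1 = A.updList (ρ x).1.1
      (A.pushList (ρ x).1.1 (A.callStep (ρ x).1.1 c).2 (ρ x).1.2.1) (ρ t).1.1 :=
  congrArg (fun s => s.2.1) hp.eq_upd

theorem PredCall.count_eq {x t : ℕ} {c : C} (hp : PredCall A α ρ x t c) :
    (ρ t).1.2.2 = A.updCount (ρ x).1.1
      (A.pushList (ρ x).1.1 (A.callStep (ρ x).1.1 c).2 (ρ x).1.2.1) (ρ t).1.1 :=
  congrArg (fun s => s.2.2) hp.eq_upd

theorem updList_of_active {p y : Q} {L : List (Entry Q)} (h : A.Active p L y) :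
    A.updList p L y = L := if_pos h

theorem updCount_of_active {p y : Q} {L : List (Entry Q)} (h : A.Active p L y) :
    A.updCount p L y = L.length := if_pos h

/-- An odd state with the least number of records shows that no step before is final. -/
theorem notMem_final_of_isOdd (h : A.tracker.IsRun α ρ) {s t k : ℕ} (hs : IsStairStep ρ s)
    (hk : ∀ t, s ≤ t → k ≤ (ρ t).1.2.2) (hst : s ≤ t) (hodd : A.IsOdd (ρ t).1)
    (hd : (ρ t).1.2.2 = k) : (ρ s).1.1 ∉ A.final := by
  induction t using Nat.strong_induction_on with
  | _ t ih =>
    rcases hst.eq_or_lt with rfl | hst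
    · exact hodd.1
    obtain ⟨x, hx | ⟨c, hx⟩⟩ := exists_pred h (show 0 < t by omega)
    · have hsx := hx.le_of_isStairStep hs hst
      have h1 := hodd.2
      -- An odd state comes from an active move. Its predecessor is nonfinal and has exactly `k`
      -- records, all of them survivors since `k` is least; so it is odd as well, and the descent
      -- goes on to `s`.
      have hact := active_of_length hodd.1 (by rw [← hx.list_eq, ← hx.count_eq, h1])
      have h2 := hx.count_eq
      rw [updCount_of_active hact, hd] at h2
      have h3 := count_le_length h x
      have h4 := hk x hsx
      exact ih x hx.lt hsx ⟨hact.1, by omega⟩ (by omega)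
    · have hsx : s ≤ x := by have := hx.eq_succ; omega
      have h1 := hodd.2
      have hact := active_of_length hodd.1 (by rw [← hx.list_eq, ← hx.count_eq, h1])
      have h2 := hx.count_eq
      rw [updCount_of_active hact, hd, length_pushList] at h2
      have h3 := count_le_length h x
      have h4 := hk x hsx
      exact ih x (by have := hx.eq_succ; omega) hsx ⟨hact.1, by omega⟩ (by omega)

/-- If the number of surviving records is large on late steps, then on all late positions. -/
theorem eventually_le_count (h : A.tracker.IsRun α ρ) {k n : ℕ}
    (hk : ∀ s, n ≤ s → IsStairStep ρ s → k ≤ (ρ s).1.2.2) :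
    ∀ᶠ t in atTop, k ≤ (ρ t).1.2.2 := by
  obtain ⟨s, hns, hs⟩ := exists_isStairStep ρ n
  filter_upwards [eventually_gt_atTop s] with t ht
  have hex := exists_isStairStep ρ t
  classical
  obtain ⟨htj, hj⟩ := Nat.find_spec hex
  have hmin := fun m => Nat.find_min (H := hex) (m := m)
  generalize Nat.find hex = j at htj hj hmin
  have hkj := hk j (by omega) hj
  rcases htj.eq_or_lt with rfl | htj
  · exact hkj
  -- `j` is the first step from `t` on. Its predecessor is a step too, hence lies before `t`, and
  -- `t` is inside a matched factor ending at `j`.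
  obtain ⟨x, hx | ⟨c, hx⟩⟩ := exists_pred h (show 0 < j by omega)
  · rcases lt_or_ge x t with h1 | h1
    · exact hkj.trans (hx.count_le h h1 htj)
    · exact absurd ⟨h1, hx.isStairStep hj⟩ (hmin x hx.lt)
  · have := hx.eq_succ
    exact absurd ⟨by omega, hx.isStairStep hj⟩ (hmin x (by omega))

/-- The lowest `k` records are never dropped and, on steps, never include the top one. Calls
therefore change them only by `pushEntry`, and popping carries their later target to the earlier
one. -/
theorem climb_of_isStairStep [Nonempty R] (h : A.tracker.IsRun α ρ) {k n a c : ℕ}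
    (hF : ∀ s, n ≤ s → IsStairStep ρ s → (ρ s).1.1 ∉ A.final)
    (hd : ∀ s, n ≤ s → k ≤ (ρ s).1.2.2)
    (hL : ∀ s, n ≤ s → IsStairStep ρ s → k < (ρ s).1.2.1.length)
    (hna : n ≤ a) (ha : IsStairStep ρ a) (hac : a ≤ c) (hc : IsStairStep ρ c) :
    A.Climb (ρ a).1.1 (target (low k (ρ a).1.2.1)) (ρ c).1.1 (target (low k (ρ c).1.2.1)) := by
  induction c using Nat.strong_induction_on with
  | _ c ih =>
    rcases hac.eq_or_lt with rfl | hac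
    · exact climb_self (hF a hna ha) subset_rfl
    obtain ⟨x, hx | ⟨l, hx⟩⟩ := exists_pred h (show 0 < c by omega)
    · have hax := hx.le_of_isStairStep ha hac
      have hxs := hx.isStairStep hc
      refine (ih x hx.lt hax hxs).trans ?_
      obtain ⟨w, hw⟩ := hx.exists_move h
      refine ⟨w, [], hw.nonfinal (hF x (by omega) hxs) (hF c (by omega) hc), mapsTo_nil ?_⟩
      rw [hx.list_eq, low_updList]
      rw [← hx.count_eq]
      exact hd c (by omega)
    · have hax : a ≤ x := by have := hx.eq_succ; omega
      have hxs := hx.isStairStep hc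
      refine (ih x (by have := hx.eq_succ; omega) hax hxs).trans ?_
      refine ⟨_, _, hx.move.nonfinal (hF x (by omega) hxs) (hF c (by omega) hc), ?_⟩
      rw [hx.list_eq, low_updList, low_pushList (hL x (by omega) hxs)]
      · exact mapsTo_target_map _ _
      · rw [← hx.count_eq]
        exact hd c (by omega)

/-- On late steps, all situations can be reached from each other. -/
theorem exists_climb_of_isStairStep [Finite Q] [Nonempty R] (h : A.tracker.IsRun α ρ) {k n : ℕ}
    (hF : ∀ s, n ≤ s → IsStairStep ρ s → (ρ s).1.1 ∉ A.final)
    (hd : ∀ s, n ≤ s → k ≤ (ρ s).1.2.2)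
    (hL : ∀ s, n ≤ s → IsStairStep ρ s → k < (ρ s).1.2.1.length) :
    ∃ m, n ≤ m ∧ IsStairStep ρ m ∧ ∀ a c, m ≤ a → m ≤ c → IsStairStep ρ a → IsStairStep ρ c →
      A.Climb (ρ a).1.1 (target (low k (ρ a).1.2.1)) (ρ c).1.1 (target (low k (ρ c).1.2.1)) := by
  let f : ℕ → Q × Set Q := fun s => ((ρ s).1.1, target (low k (ρ s).1.2.1))
  -- There are finitely many situations, so every situation on a late step recurs. This turns
  -- forward climbs into climbs in both directions.
  have h1 : ∀ᶠ s in atTop, ∀ x, IsStairStep ρ s ∧ f s = x →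
      ∃ᶠ s' in atTop, IsStairStep ρ s' ∧ f s' = x := by
    refine eventually_all.2 fun x => ?_
    by_cases hx : ∃ᶠ s' in atTop, IsStairStep ρ s' ∧ f s' = x
    · exact Eventually.of_forall fun _ _ => hx
    · filter_upwards [not_frequently.1 hx] with s hs hs'
      exact absurd hs' hs
  obtain ⟨m', hm'⟩ := eventually_atTop.1 h1
  obtain ⟨m, hm, hms⟩ := exists_isStairStep ρ (max m' n)
  refine ⟨m, by omega, hms, fun a c hma hmc ha hc => ?_⟩
  obtain ⟨c', hc', hcs, heq⟩ := frequently_atTop.1 (hm' c (by omega) _ ⟨hc, rfl⟩) a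
  have h2 := climb_of_isStairStep h hF hd hL (show n ≤ a by omega) ha hc' hcs
  simp only [f, Prod.mk.injEq] at heq
  rwa [heq.1, heq.2] at h2

theorem exists_eq_cons_low_of_updCount {p y : Q} {L : List (Entry Q)} (hy : y ∉ A.final)
    (h : A.updCount p L y < (A.updList p L y).length) :
    A.updList p L y = (y, target (low (A.updCount p L y) (A.updList p L y)), ∅) ::
      low (A.updCount p L y) (A.updList p L y) ∧
      (low (A.updCount p L y) (A.updList p L y)).length = A.updCount p L y := by
  have hact : ¬ A.Active p L y := fun hc => by
    rw [updCount_of_active hc, updList_of_active hc] at h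
    omega
  have h1 : A.updCount p L y = (kept L y).length := if_neg hact
  have h2 : A.updList p L y = (y, target (kept L y), ∅) :: kept L y := by
    rw [updList, if_neg hact, if_neg hy]
  rw [h1, h2, low_cons le_rfl, low_length]
  exact ⟨rfl, rfl⟩

/-- If all late steps are not final, then an odd state with the least number of records occurs
infinitely often. -/
theorem frequently_isOdd [Finite Q] [Nonempty R] (h : A.tracker.IsRun α ρ) {k : ℕ}
    (hF : ∀ᶠ s in atTop, IsStairStep ρ s → (ρ s).1.1 ∉ A.final)
    (hd : ∀ᶠ s in atTop, k ≤ (ρ s).1.2.2) (hk : ∃ᶠ s in atTop, (ρ s).1.2.2 = k) :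
    ∃ᶠ s in atTop, A.IsOdd (ρ s).1 ∧ (ρ s).1.2.2 = k := by
  by_contra hcon
  obtain ⟨n, hn⟩ := eventually_atTop.1 ((hF.and hd).and (not_frequently.1 hcon))
  replace hF : ∀ s, n ≤ s → IsStairStep ρ s → (ρ s).1.1 ∉ A.final := fun s hs => (hn s hs).1.1
  replace hd : ∀ s, n ≤ s → k ≤ (ρ s).1.2.2 := fun s hs => (hn s hs).1.2
  have hL : ∀ s, n ≤ s → IsStairStep ρ s → k < (ρ s).1.2.1.length := by
    intro s hs hst
    have h1 := count_le_length h s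
    have h2 := hd s hs
    by_contra h3
    exact (hn s hs).2 ⟨⟨hF s hs hst, by omega⟩, by omega⟩
  obtain ⟨m, hnm, hm, hcl⟩ := exists_climb_of_isStairStep h hF hd hL
  -- More than `k` survivors on all late steps would give more than `k` at all late positions,
  -- against the choice of `k`.
  suffices key : ∃ m', ∀ s, m' ≤ s → IsStairStep ρ s → k + 1 ≤ (ρ s).1.2.2 by
    obtain ⟨m', hm'⟩ := key
    obtain ⟨s, hs1, hs2⟩ := (hk.and_eventually (eventually_le_count h hm')).exists
    omega
  by_cases hall : ∀ s, m + 1 ≤ s → IsStairStep ρ s → k + 1 ≤ (ρ s).1.2.2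
  · exact ⟨_, hall⟩
  push Not at hall
  obtain ⟨j, hmj, hj, hdj⟩ := hall
  have hdj' : (ρ j).1.2.2 = k := le_antisymm (by omega) (hd j (by omega))
  have hLj : (ρ j).1.2.1 = ((ρ j).1.1, target (low k (ρ j).1.2.1), ∅) :: low k (ρ j).1.2.1 ∧
      (low k (ρ j).1.2.1).length = k := by
    have h1 := hL j (by omega) hj
    have h2 := hF j (by omega) hj
    obtain ⟨x, hx | ⟨l, hx⟩⟩ := exists_pred h (show 0 < j by omega)
    · have h3 := hx.count_eq
      rw [hdj'] at h3
      rw [hx.list_eq] at h1 ⊢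
      rw [h3] at h1 ⊢
      exact exists_eq_cons_low_of_updCount h2 h1
    · have h3 := hx.count_eq
      rw [hdj'] at h3
      rw [hx.list_eq] at h1 ⊢
      rw [h3] at h1 ⊢
      exact exists_eq_cons_low_of_updCount h2 h1
  -- The record made at `j` stays on top at all later steps: its situation can be reached by a climb
  -- from each of theirs, so every move between them is active.
  have hinv : ∀ s, j ≤ s → IsStairStep ρ s → (j < s → (ρ s).1.2.2 = k + 1) ∧
      (low k (ρ s).1.2.1).length = k ∧ ∃ Y,
        (ρ s).1.2.1 = ((ρ j).1.1, target (low k (ρ j).1.2.1), Y) :: low k (ρ s).1.2.1 := by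
    intro s
    induction s using Nat.strong_induction_on with
    | _ s ih =>
      intro hjs hs
      rcases hjs.eq_or_lt with rfl | hjs
      · exact ⟨fun h => absurd h (lt_irrefl _), hLj.2, ∅, hLj.1⟩
      have hc := hcl s j (by omega) (by omega) hs hj
      have hds := hd s (by omega)
      obtain ⟨x, hx | ⟨l, hx⟩⟩ := exists_pred h (show 0 < s by omega)
      · have hjx := hx.le_of_isStairStep hj hjs
        have hxs := hx.isStairStep hs
        obtain ⟨-, hlen, Y, hY⟩ := ih x hx.lt hjx hxs
        have hlow : low k (ρ s).1.2.1 = low k (ρ x).1.2.1 := by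
          rw [hx.list_eq, low_updList (by rwa [← hx.count_eq])]
        have hact : A.Active (ρ x).1.1 (ρ x).1.2.1 (ρ s).1.1 :=
          ⟨hF x (by omega) hxs, _, _, hY, by rwa [← hlow]⟩
        refine ⟨fun _ => ?_, by rwa [hlow], Y, ?_⟩
        · rw [hx.count_eq, updCount_of_active hact, hY, List.length_cons, hlen]
        · rw [hlow, ← hY, hx.list_eq, updList_of_active hact]
      · have hjx : j ≤ x := by have := hx.eq_succ; omega
        have hxs := hx.isStairStep hs
        obtain ⟨-, hlen, Y, hY⟩ := ih x (by have := hx.eq_succ; omega) hjx hxs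
        have hlow : low k (ρ s).1.2.1 = (low k (ρ x).1.2.1).map
            (A.pushEntry (A.callStep (ρ x).1.1 l).2) := by
          rw [hx.list_eq, low_updList (by rwa [← hx.count_eq]),
            low_pushList (hL x (by omega) hxs)]
        have hpush : ∃ Y', A.pushList (ρ x).1.1 (A.callStep (ρ x).1.1 l).2 (ρ x).1.2.1 =
            ((ρ j).1.1, target (low k (ρ j).1.2.1), Y') :: low k (ρ s).1.2.1 := by
          rw [hlow]
          generalize low k (ρ x).1.2.1 = K at hY ⊢
          rw [hY]
          exact ⟨_, rfl⟩
        obtain ⟨Y', hY'⟩ := hpush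
        have hact : A.Active (ρ x).1.1
            (A.pushList (ρ x).1.1 (A.callStep (ρ x).1.1 l).2 (ρ x).1.2.1) (ρ s).1.1 :=
          ⟨hF x (by omega) hxs, _, _, hY', hc⟩
        have hlen' : (low k (ρ s).1.2.1).length = k := by rw [hlow, List.length_map, hlen]
        refine ⟨fun _ => ?_, hlen', Y', ?_⟩
        · rw [hx.count_eq, updCount_of_active hact, hY', List.length_cons, hlen']
        · rw [← hY', hx.list_eq, updList_of_active hact]
  exact ⟨j + 1, fun s hs hst => ((hinv s (by omega) hst).1 (by omega)).ge⟩

theorem exists_least_frequently {f : ℕ → ℕ} {N : ℕ} (hf : ∀ n, f n ≤ N) :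
    ∃ k, (∀ᶠ n in atTop, k ≤ f n) ∧ ∃ᶠ n in atTop, f n = k := by
  have hex : ∃ k, ∃ᶠ n in atTop, f n ≤ k := ⟨N, (Eventually.of_forall hf).frequently⟩
  classical
  have h1 := Nat.find_spec hex
  have h2 := fun m => Nat.find_min (H := hex) (m := m)
  generalize Nat.find hex = k at h1 h2
  have h3 : ∀ᶠ n in atTop, k ≤ f n := by
    rcases Nat.eq_zero_or_pos k with rfl | hk
    · exact Eventually.of_forall fun _ => Nat.zero_le _
    · filter_upwards [not_frequently.1 (h2 (k - 1) (by omega))] with n hn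
      omega
  exact ⟨k, h3, (h1.and_eventually h3).mono fun n hn => le_antisymm hn.1 hn.2⟩

theorem length_le_card [Finite Q] {L : List (Entry Q)} (h : (reps L).Nodup) :
    L.length ≤ Nat.card (Q × Set Q) := by
  have := Fintype.ofFinite (Q × Set Q)
  rw [Nat.card_eq_fintype_card, ← List.length_map (fun e : Entry Q => (e.1, e.2.1))]
  exact h.length_le_card

/-- The acceptance of `A` in terms of the tracker. -/
theorem frequently_final_iff [Finite Q] [Nonempty R] (h : A.tracker.IsRun α ρ) {k : ℕ}
    (hd : ∀ᶠ s in atTop, k ≤ (ρ s).1.2.2) (hk : ∃ᶠ s in atTop, (ρ s).1.2.2 = k) :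
    (∃ᶠ s in atTop, IsStairStep ρ s ∧ (ρ s).1.1 ∈ A.final) ↔
      ¬ ∃ᶠ s in atTop, A.IsOdd (ρ s).1 ∧ (ρ s).1.2.2 = k := by
  constructor
  · intro h1 h2
    obtain ⟨n, hn⟩ := eventually_atTop.1 hd
    obtain ⟨s, hs, hst, hF⟩ := frequently_atTop.1 h1 n
    obtain ⟨t, ht, hodd, hdt⟩ := frequently_atTop.1 h2 s
    exact notMem_final_of_isOdd h hst (fun t ht => hn t (by omega)) ht hodd hdt hF
  · intro h1
    by_contra h2
    refine h1 (frequently_isOdd h ?_ hd hk)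
    exact (not_frequently.1 h2).mono fun s hs h3 h4 => hs ⟨h3, h4⟩

end StairBuchiDVPA

/-! ### Restriction of an automaton to the finite part that its runs use. -/

/-- Points outside `X₀` receive an arbitrary code, and `h'` serves only to provide one. The codes
live in `Type`, as the automaton to be constructed demands. -/
theorem exists_encoding {X : Type*} {X₀ : Set X} (h : X₀.Finite) (h' : Nonempty X → X₀.Nonempty) :
    ∃ (Y : Type) (_ : Finite Y) (f : Y → X) (f' : X → Y), ∀ x ∈ X₀, f (f' x) = x := by
  have := h.to_subtype
  obtain ⟨n, ⟨e⟩⟩ := Finite.exists_equiv_fin X₀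
  classical
  exact ⟨Fin n, inferInstance, fun y => (e.symm y).1,
    fun x => if hx : x ∈ X₀ then e ⟨x, hx⟩ else e ⟨_, (h' ⟨x⟩).some_mem⟩,
    fun x hx => by simp [hx]⟩

namespace ParityDVPA

open DVPMachine

variable {C I R S G : Type*}

theorem language_eq_of_priority_eq {S' G' : Type*} {B : ParityDVPA C I R S G}
    {B' : ParityDVPA C I R S' G'}
    (h : ∀ α ρ, B.IsRun α ρ →
      ∃ ρ', B'.IsRun α ρ' ∧ ∀ n, B'.priority (ρ' n).1 = B.priority (ρ n).1) :
    B'.language = B.language := by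
  ext α
  constructor
  · rintro ⟨ρ', hρ', k, hk, hg⟩
    obtain ⟨ρ, hρ, -⟩ := hρ'.exists_isRun B.toDVPMachine
    obtain ⟨ρ'', hρ'', hpr⟩ := h α ρ hρ
    obtain rfl := hρ'.unique hρ''
    simp only [hpr] at hg
    exact ⟨ρ, hρ, k, hk, hg⟩
  · rintro ⟨ρ, hρ, k, hk, hg⟩
    obtain ⟨ρ', hρ', hpr⟩ := h α ρ hρ
    refine ⟨ρ', hρ', k, hk, ?_⟩
    simpa only [hpr] using hg

/-- A parity automaton all of whose runs stay in a finite part is equivalent to a finite one. -/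
theorem exists_finite_of_finite_range (B : ParityDVPA C I R S G) {S₀ : Set S} {G₀ : Set G}
    (hS : S₀.Finite) (hG : G₀.Finite) (hG' : Nonempty G → G₀.Nonempty) (hinit : B.init ∈ S₀)
    (hcall : ∀ q ∈ S₀, ∀ c, (B.callStep q c).2 ∈ G₀)
    (hrun : ∀ α ρ, B.IsRun α ρ → ∀ n, (ρ n).1 ∈ S₀) :
    ∃ (Q' Γ' : Type) (_ : Finite Q') (_ : Finite Γ') (B' : ParityDVPA C I R Q' Γ'),
      B'.language = B.language := by
  obtain ⟨Q', hQ', f, f', hf⟩ := exists_encoding hS fun _ => ⟨_, hinit⟩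
  obtain ⟨Γ', hΓ', g, g', hg⟩ := exists_encoding hG hG'
  refine ⟨Q', Γ', hQ', hΓ', ⟨⟨f' B.init, fun q c => (f' (B.callStep (f q) c).1,
    g' (B.callStep (f q) c).2), fun q Z r => f' (B.retStep (f q) (g Z) r),
    fun q a => f' (B.intStep (f q) a)⟩, fun q => B.priority (f q)⟩,
    language_eq_of_priority_eq fun α ρ h => ?_⟩
  have hstack : ∀ n, ∀ Z ∈ (ρ n).2, Z ∈ G₀ := by
    intro n
    induction n with
    | zero => simp [h.1]
    | succ n ih =>
      have h1 := h.2 n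
      have h2 := hrun α ρ h n
      revert h1 ih h2
      generalize ρ (n + 1) = κ'
      generalize ρ n = κ
      obtain ⟨q, s⟩ := κ
      intro ih h1 hq
      cases hα : α n with
      | call c =>
        rw [hα, step, Option.some.injEq] at h1
        subst h1
        rintro Z (_ | ⟨_, hZ⟩)
        · exact hcall q hq c
        · exact ih Z hZ
      | internal a =>
        rw [hα, step, Option.some.injEq] at h1
        subst h1
        exact ih
      | ret r =>
        cases s with
        | nil => simp [hα, step] at h1
        | cons Z s =>
          rw [hα, step, Option.some.injEq] at h1
          subst h1
          exact fun Z' hZ' => ih Z' (List.mem_cons_of_mem _ hZ')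
  refine ⟨fun n => (f' (ρ n).1, (ρ n).2.map g'), ⟨by simp [h.1], fun n => ?_⟩, fun n => ?_⟩
  · have h1 := h.2 n
    have h2 := hrun α ρ h n
    have h3 := hstack n
    revert h1 h2 h3
    dsimp only
    generalize ρ (n + 1) = κ'
    generalize ρ n = κ
    obtain ⟨q, s⟩ := κ
    intro h1 h2 h3
    cases hα : α n with
    | call c =>
      rw [hα, step, Option.some.injEq] at h1
      subst h1
      simp [step, hf q h2]
    | internal a =>
      rw [hα, step, Option.some.injEq] at h1
      subst h1
      simp [step, hf q h2]
    | ret r =>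
      cases s with
      | nil => simp [hα, step] at h1
      | cons Z s =>
        rw [hα, step, Option.some.injEq] at h1
        subst h1
        simp [step, hf q h2, hg Z (h3 Z List.mem_cons_self)]
  · exact congrArg B.priority (hf _ (hrun α ρ h n))

theorem mem_language_iff_even {B : ParityDVPA C I R S G} {α : ℕ → VPLetter C I R}
    {ρ : ℕ → VPConf S G} (h : B.IsRun α ρ) {m : ℕ}
    (hle : ∀ᶠ n in atTop, B.priority (ρ n).1 ≤ m) (hm : ∃ᶠ n in atTop, B.priority (ρ n).1 = m) :
    α ∈ B.language ↔ Even m := by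
  have hg : IsGreatest {p : ℕ | ∃ᶠ n in atTop, B.priority (ρ n).1 = p} m := by
    refine ⟨hm, fun p hp => ?_⟩
    obtain ⟨n, h1, h2⟩ := (hp.and_eventually hle).exists
    omega
  constructor
  · rintro ⟨ρ', hρ', k, hk, hg'⟩
    obtain rfl := h.unique hρ'
    rwa [hg.unique hg']
  · exact fun he => ⟨ρ, h, m, he, hg⟩

end ParityDVPA

/-! ### Sufficiency: the equivalent parity automaton. -/

namespace StairBuchiDVPA

open VPLetter DVPMachine

variable {C I R Q Γ : Type*} {A : StairBuchiDVPA C I R Q Γ}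

theorem mem_language_iff {α : ℕ → VPLetter C I R} {ρ : ℕ → VPConf Q Γ} (h : A.IsRun α ρ) :
    α ∈ A.language ↔ ∃ᶠ n in atTop, IsStairStep ρ n ∧ (ρ n).1 ∈ A.final := by
  constructor
  · rintro ⟨ρ', hρ', hf⟩
    rwa [h.unique hρ']
  · exact fun hf => ⟨ρ, h, hf⟩

theorem language_eq_of_forall_isRun {S G : Type*} {B : ParityDVPA C I R S G}
    (h : ∀ α ρ, B.IsRun α ρ → (α ∈ B.language ↔ α ∈ A.language)) : B.language = A.language := by
  ext α
  constructor
  · rintro ⟨ρ, hρ, hα⟩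
    exact (h α ρ hρ).1 ⟨ρ, hρ, hα⟩
  · rintro ⟨ρ, hρ, hα⟩
    obtain ⟨ρ', hρ', -⟩ := hρ.exists_isRun B.toDVPMachine
    exact (h α ρ' hρ').2 ⟨ρ, hρ, hα⟩

open Classical in
/-- Without return letters, all positions are steps. -/
theorem exists_parity_of_isEmpty [IsEmpty R] (A : StairBuchiDVPA C I R Q Γ) [Finite Q] [Finite Γ] :
    ∃ (Q' Γ' : Type) (_ : Finite Q') (_ : Finite Γ') (B : ParityDVPA C I R Q' Γ'),
      B.language = A.language := by
  let B : ParityDVPA C I R Q Γ := ⟨A.toDVPMachine, fun q => if q ∈ A.final then 2 else 1⟩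
  suffices hB : B.language = A.language by
    rw [← hB]
    exact B.exists_finite_of_finite_range (S₀ := Set.univ) (G₀ := Set.univ) Set.finite_univ
      Set.finite_univ (fun _ => Set.univ_nonempty) trivial (fun _ _ _ => trivial)
      fun _ _ _ _ => trivial
  refine language_eq_of_forall_isRun fun α ρ hB => ?_
  have h : A.IsRun α ρ := hB
  have hstep : ∀ n, IsStairStep ρ n := by
    refine fun n m hnm => monotone_nat_of_le_succ (f := fun n => (ρ n).2.length) (fun n => ?_) hnm
    have h1 := step_height (h.2 n)
    have h2 : 0 ≤ weight (α n) := by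
      cases α n with
      | call c => simp [weight]
      | internal a => simp [weight]
      | ret r => exact isEmptyElim r
    omega
  rw [mem_language_iff h]
  simp only [hstep, true_and]
  by_cases hF : ∃ᶠ n in atTop, (ρ n).1 ∈ A.final
  · rw [ParityDVPA.mem_language_iff_even hB (m := 2)]
    · exact iff_of_true even_two hF
    · refine Eventually.of_forall fun n => ?_
      simp only [B]
      split_ifs <;> omega
    · exact hF.mono fun n hn => if_pos hn
  · rw [ParityDVPA.mem_language_iff_even hB (m := 1)]
    · exact iff_of_false (by decide) hF
    · exact (not_frequently.1 hF).mono fun n hn => (if_neg hn).le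
    · exact ((not_frequently.1 hF).mono fun n hn => if_neg hn).frequently

open Classical in
/-- The tracker with the priorities given by the number of records that survive the last move. -/
noncomputable def parityTracker (A : StairBuchiDVPA C I R Q Γ) (N : ℕ) :
    ParityDVPA C I R (TrackState Q) (TrackState Q × Γ) where
  toDVPMachine := A.tracker
  priority s := 2 * (N - s.2.2) + if A.IsOdd s then 1 else 0

theorem language_parityTracker [Finite Q] [Nonempty R] (hA : ¬ A.HasForbiddenPattern) :
    (A.parityTracker (Nat.card (Q × Set Q))).language = A.language := by
  classical
  refine language_eq_of_forall_isRun fun α ρ hB => ?_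
  have h : A.tracker.IsRun α ρ := hB
  have hN : ∀ n, (ρ n).1.2.2 ≤ Nat.card (Q × Set Q) := fun n =>
    (count_le_length h n).trans (length_le_card (listInv_of_isRun hA h n).2)
  generalize Nat.card (Q × Set Q) = N at hB hN
  obtain ⟨k, hd, hk⟩ := exists_least_frequently hN
  have hacc := frequently_final_iff h hd hk
  have hpr : ∀ n, (A.parityTracker N).priority (ρ n).1 =
    2 * (N - (ρ n).1.2.2) + if A.IsOdd (ρ n).1 then 1 else 0 := fun _ => rfl
  rw [mem_language_iff (isRun_of_tracker h)]
  simp only [IsStairStep, List.length_map] at hacc ⊢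
  rw [hacc]
  by_cases hodd : ∃ᶠ s in atTop, A.IsOdd (ρ s).1 ∧ (ρ s).1.2.2 = k
  · rw [ParityDVPA.mem_language_iff_even hB (m := 2 * (N - k) + 1)]
    · exact iff_of_false (by simp) (not_not.2 hodd)
    · refine hd.mono fun n hn => ?_
      rw [hpr]
      split_ifs <;> omega
    · refine hodd.mono fun n hn => ?_
      rw [hpr, if_pos hn.1, hn.2]
  · rw [ParityDVPA.mem_language_iff_even hB (m := 2 * (N - k))]
    · exact iff_of_true (by simp) hodd
    · filter_upwards [hd, not_frequently.1 hodd] with n h1 h2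
      -- A late odd state has more than `k` survivors, so its priority is at most 2(N - k - 1) + 1 <
      -- 2(N - k); `h3` makes this valid for truncated subtraction.
      have h3 := hN n
      rw [hpr]
      split_ifs with h4
      · have : (ρ n).1.2.2 ≠ k := fun h5 => h2 ⟨h4, h5⟩
        omega
      · omega
    · refine (hk.and_eventually (not_frequently.1 hodd)).mono fun n hn => ?_
      rw [hpr, if_neg fun h4 => hn.2 ⟨h4, hn.1⟩, hn.1, add_zero]

/-- Without forbidden patterns, there is an equivalent parity automaton. -/
theorem exists_parity_of_not_hasForbiddenPattern [Finite Q] [Finite Γ]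
    (hA : ¬ A.HasForbiddenPattern) :
    ∃ (Q' Γ' : Type) (_ : Finite Q') (_ : Finite Γ') (B : ParityDVPA C I R Q' Γ'),
      B.language = A.language := by
  -- The invariant of the tracker needs every stack symbol to be poppable, so the case without
  -- return letters is separate.
  rcases isEmpty_or_nonempty R with hR | hR
  · exact A.exists_parity_of_isEmpty
  rw [← language_parityTracker hA]
  let S₀ : Set (TrackState Q) := {s | s.2.1.length ≤ Nat.card (Q × Set Q) ∧
    s.2.2 ≤ Nat.card (Q × Set Q)}
  have hS : S₀.Finite := by
    refine ((Set.finite_univ (α := Q)).prod ((List.finite_length_le (Entry Q)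
      (Nat.card (Q × Set Q))).prod
      (Set.finite_Iic (Nat.card (Q × Set Q))))).subset fun s hs => ?_
    exact ⟨trivial, hs.1, hs.2⟩
  have hinit : A.upd A.init [] A.init ∈ S₀ := by
    have h1 := length_le_card (nodup_reps_updList hA (p := A.init) (y := A.init) (L := [])
      trivial (by simp) List.nodup_nil)
    exact ⟨h1, (updCount_le _ _ _).trans h1⟩
  refine ParityDVPA.exists_finite_of_finite_range _ (G₀ := S₀ ×ˢ Set.univ) hS
    (hS.prod Set.finite_univ) ?_ hinit (fun s hs c => ⟨hs, trivial⟩) fun α ρ h n => ?_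
  · rintro ⟨s, Z⟩
    exact ⟨(_, Z), hinit, trivial⟩
  · have h1 := length_le_card (listInv_of_isRun hA h n).2
    exact ⟨h1, (count_le_length h n).trans h1⟩

end StairBuchiDVPA

theorem mainTheorem1 {C I R Q Γ : Type*} [Finite C] [Finite I] [Finite R] [Finite Q] [Finite Γ]
    (A : StairBuchiDVPA C I R Q Γ) (hreach : ∀ q : Q, A.IsReachable q) :
    (∃ (Q' Γ' : Type) (_ : Finite Q') (_ : Finite Γ') (B : ParityDVPA C I R Q' Γ'),
      B.language = A.language) ↔ ¬ A.HasForbiddenPattern := by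
  constructor
  · rintro ⟨Q', Γ', _, _, B, hB⟩ ⟨q, q', q'', u, v, w, x, y, z, σ, σ', h⟩
    exact h.language_ne (hreach q') B hB
  · exact StairBuchiDVPA.exists_parity_of_not_hasForbiddenPattern
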